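/- **Setting.** Fix a deadline $T>0$. A *rate function* is a continuous, concave, increasing $r:[0,\infty)\to[0,\infty)$ with $r(0)=0$ and $\lim_{p\to\infty}r(p)=\infty$. A *policy* is a nonnegative piecewise continuous power curve $p$ on $[0,T]$ (continuous off a finite set, with finite one-sided limits everywhere); over a channel with rate $r$ it uses energy $\int_0^t p$ and sends data $\int_0^t r(p(s))\,ds$ in $[0,t]$. Given a harvested energy curve $E$ and an arrived data curve $B$, the policy is *feasible* if $\int_0^tp\le E(t)$ and $\int_0^t r(p(s))\,ds\le B(t)$ for all $t\in[0,T]$; it is *optimal* if it is feasible, sends the most data by time $T$ among feasible policies, and uses the least energy by time $T$ among the feasible policies sending that much data. A source with curves $E_s,B_s$ and rate function $r_{sr}$ transmits to a full-duplex relay with harvested energy $E_r$ and rate function $r_{rd}$, which transmits to a receiver; the data sent by the source is the arrived data at the relay. Here $E_s,E_r,B_s$ are real functions on $[0,T]$ (no regularity is needed). Let $B^*_{sr,s}$ be the data curve of an optimal policy at the source, and let $B^*_{rd}$ be the data curve of an optimal policy $p^*_{rd}$ at the relay with energy $E_r$ and arrived data $B^*_{sr,s}$. For each hop whose rate function is not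 strictly concave (where optimal policies need not be unique), the optimal policy is chosen so that its data curve is convex. Put $D=B^*_{rd}(T)$. A pair (source policy, relay policy) is *feasible* if the source policy is feasible for $E_s,B_s$ and the relay policy is feasible for $E_r$ and the data curve of the source policy. It is *optimal* if it is feasible, delivers the most data to the receiver by time $T$, and, among the feasible pairs delivering that much, minimizes the energy used at the source and the energy used at the relay. A line is *tangent* to a curve $f$ on $[0,T]$ if it meets $f$ at some $t_0\in[0,T]$ and its slope $m$ satisfies $f'(t_0^-)\le m$ if $t_0>0$ and $m\le f'(t_0^+)$ if $t_0<T$. **Theorem.** The curves $B^*_{sr,s}$ and $B^*_{rd}$ are convex on $[0,T]$, and there is a line through $(T,D)$ tangent to $B^*_{sr,s}$. Let $l$ be any such line, let $T_1=\max\{t\in[0,T] : l(t)=B^*_{sr,s}(t)\}$ (which exists), and let $$\hat B_{sr}(t)=\begin{cases}B^*_{sr,s}(t),&0\le t\le T_1,\\ l(t),&T_1<t\le T.\end{cases}$$ Then $\hat B_{sr}$ is the data curve of a policy $\hat p$ such that: 1. $\hat p$ is feasible at the source; 2. $p^*_{rd}$ remains feasible, and optimal, at the relay when the arrived data is $\hat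 B_{sr}$ instead of $B^*_{sr,s}$; 3. $\hat B_{sr}(T)=D$, and $\hat p$ uses the least energy by time $T$ among all feasible source policies that send the amount $D$ of data by time $T$. If moreover $r_{sr}$ is strictly concave, then every feasible source policy that sends the amount $D$ by time $T$ and whose data curve is not $\hat B_{sr}$ uses strictly more energy than $\hat p$; the pair $(\hat p,p^*_{rd})$ is optimal; and in every optimal pair the data curve of the source is $\hat B_{sr}$ on $[0,T]$. -/

import Mathlib

open Set Filter Topology

namespace TwoHop

/-- A rate function `r`, mapping a transmission power `p ≥ 0` to a transmission rate: continuous,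
concave, increasing, unbounded, and `r 0 = 0`. Only its values on `[0, ∞)` matter. -/
structure IsRateFunction (r : ℝ → ℝ) : Prop where
  continuousOn : ContinuousOn r (Ici 0)
  concaveOn : ConcaveOn ℝ (Ici 0) r
  monotoneOn : MonotoneOn r (Ici 0)
  tendsto_atTop : Tendsto r atTop atTop
  map_zero : r 0 = 0

/-- Piecewise continuity on `[a, b]`: continuous off a finite set, with finite one-sided limits
everywhere. -/
def PiecewiseContinuousOn (f : ℝ → ℝ) (a b : ℝ) : Prop :=
  (∃ S : Set ℝ, S.Finite ∧ ∀ t ∈ Icc a b \ S, ContinuousWithinAt f (Icc a b) t) ∧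
    (∀ t ∈ Ico a b, ∃ L : ℝ, Tendsto f (𝓝[>] t) (𝓝 L)) ∧
    (∀ t ∈ Ioc a b, ∃ L : ℝ, Tendsto f (𝓝[<] t) (𝓝 L))

/-- A transmitted power curve on `[0, T]`: nonnegative and piecewise continuous. In particular it
is bounded and integrable on `[0, T]`, and so is its composition with a rate function. -/
structure IsPowerCurve (T : ℝ) (p : ℝ → ℝ) : Prop where
  nonneg : ∀ t ∈ Icc 0 T, 0 ≤ p t
  piecewiseContinuousOn : PiecewiseContinuousOn p 0 T

/-- The energy used by the power curve `p` in `[0, t]`. -/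
noncomputable def energyCurve (p : ℝ → ℝ) (t : ℝ) : ℝ :=
  ∫ s in (0 : ℝ)..t, p s

/-- The amount of data sent by the power curve `p` in `[0, t]` over a channel with rate
function `r`. -/
noncomputable def dataCurve (r p : ℝ → ℝ) (t : ℝ) : ℝ :=
  ∫ s in (0 : ℝ)..t, r (p s)

/-- Feasibility of `p` at one transmitter with harvested energy curve `E` and arrived data
curve `B`: energy causality and data causality on `[0, T]`. -/
structure IsFeasible (T : ℝ) (r E B p : ℝ → ℝ) : Prop where
  isPowerCurve : IsPowerCurve T p
  energy_le : ∀ t ∈ Icc 0 T, energyCurve p t ≤ E t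
  data_le : ∀ t ∈ Icc 0 T, dataCurve r p t ≤ B t

/-- Optimality for the point-to-point throughput maximization problem: `p` sends the maximum
amount of data by time `T`, and uses the least energy among the power curves that do so. -/
structure IsOptimal (T : ℝ) (r E B p : ℝ → ℝ) : Prop where
  isFeasible : IsFeasible T r E B p
  data_max : ∀ p', IsFeasible T r E B p' → dataCurve r p' T ≤ dataCurve r p T
  energy_min : ∀ p', IsFeasible T r E B p' → dataCurve r p' T = dataCurve r p T →
    energyCurve p T ≤ energyCurve p' T

/-- Feasibility of the pair (`p` at the source, `q` at the relay) for the two-hop problem: the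
arrived data at the relay is what the source has sent. -/
structure IsFeasiblePair (T : ℝ) (rsr rrd Es Er Bs p q : ℝ → ℝ) : Prop where
  source : IsFeasible T rsr Es Bs p
  relay : IsFeasible T rrd Er (dataCurve rsr p) q

/-- Optimality for the two-hop problem: the pair delivers the maximum amount of data to the
receiver by time `T`, and among the pairs that do so it minimizes the energy used in the source
and the energy used in the relay. -/
structure IsOptimalPair (T : ℝ) (rsr rrd Es Er Bs p q : ℝ → ℝ) : Prop where
  isFeasiblePair : IsFeasiblePair T rsr rrd Es Er Bs p q
  data_max : ∀ p' q', IsFeasiblePair T rsr rrd Es Er Bs p' q' →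
    dataCurve rrd q' T ≤ dataCurve rrd q T
  source_energy_min : ∀ p' q', IsFeasiblePair T rsr rrd Es Er Bs p' q' →
    dataCurve rrd q' T = dataCurve rrd q T → energyCurve p T ≤ energyCurve p' T
  relay_energy_min : ∀ p' q', IsFeasiblePair T rsr rrd Es Er Bs p' q' →
    dataCurve rrd q' T = dataCurve rrd q T → energyCurve q T ≤ energyCurve q' T

/-- The line of slope `m` through the point `(T, D)`. -/
def line (T D m t : ℝ) : ℝ := D + m * (t - T)

/-- The line of slope `m` through `(T, D)` is tangent to the graph of `f` over `[0, T]`: it meets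
the graph at some `t₀ ∈ [0, T]` and its slope lies between the left and the right derivative of
`f` at `t₀`. So `m = f'(t₀)` at an interior point of differentiability, and at a corner of a convex
curve every slope between the two one-sided ones is allowed. At an endpoint of `[0, T]` only the
one-sided derivative from inside exists, and only its inequality is required. -/
def IsTangent (T : ℝ) (f : ℝ → ℝ) (D m : ℝ) : Prop :=
  ∃ t₀ ∈ Icc 0 T, line T D m t₀ = f t₀ ∧
    (0 < t₀ → ∃ d, HasDerivWithinAt f d (Iio t₀) t₀ ∧ d ≤ m) ∧
    (t₀ < T → ∃ d, HasDerivWithinAt f d (Ioi t₀) t₀ ∧ m ≤ d)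

/-- `T₁` is the last point of `[0, T]` where the line of slope `m` through `(T, D)` meets `f`. -/
def IsLastMeeting (T : ℝ) (f : ℝ → ℝ) (D m T₁ : ℝ) : Prop :=
  IsGreatest {t | t ∈ Icc 0 T ∧ line T D m t = f t} T₁

/-- The curve that follows `f` up to time `T₁` and then the line of slope `m` through `(T, D)`. -/
noncomputable def hatCurve (T : ℝ) (f : ℝ → ℝ) (D m T₁ t : ℝ) : ℝ :=
  if t ≤ T₁ then f t else line T D m t

end TwoHop

/-!
Both optimality notions are convex in the rate curves, and the proof rests on three facts about a
single transmitter with a rate function `r`.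

*Comparison* (`energyCurve_sub_le_of_monotoneOn`). Let `q` have increasing power. The inverse of `r`
is convex, and its derivative along `q`, the marginal cost of data, is an increasing function of
time. Used as a Lagrange multiplier, it shows that `q` is no more expensive than any `p` that sends
at least as much data in the final intervals `[x, b]` which start where the power of `q` increases.

*Convexification* (`IsPowerCurve.exists_convexification`). The greatest convex minorant of a data
curve is again the data curve of a policy: its slope is continuous wherever the original power is.
By comparison this policy has used no more energy at any time. So convex data curves suffice, and
optimal ones are convex when `r` is strictly concave, since the cheapest way of sending a given
amount is then unique (`IsFeasible.dataCurve_eq_of_energyCurve_le`).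

*Domination* (`IsOptimal.dataCurve_le_of_monotoneOn`). For strictly concave `r` the optimal data
curve is above every feasible convex one. Where a convex curve is ahead, it is the cheaper of the
two by comparison, and following it there would give a second optimal policy.

The policy that follows the tangent is feasible because it is below the optimal data curve and
cheaper, and it is the cheapest for its amount of data by comparison and Jensen's inequality
(`IsTangentSetup.energyCurve_le`). The relay loses nothing, as its convex data curve is below the
tangent after the last meeting point. No other source policy helps the relay: convexifying the
policies of both hops puts the relay's curve below the source-optimal one
(`IsFeasiblePair.relay_le`).
-/

namespace TwoHop

open MeasureTheory intervalIntegral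

/-! ### Rate functions -/

namespace IsRateFunction

variable {r : ℝ → ℝ}

/-- If a concave function has slope zero somewhere, it stays bounded afterwards, so an unbounded
monotone concave function is strictly increasing. -/
lemma strictMonoOn (hr : IsRateFunction r) : StrictMonoOn r (Ici 0) := by
  intro x hx y hy hxy
  refine lt_of_le_of_ne (hr.monotoneOn hx hy hxy.le) fun heq => ?_
  obtain ⟨z, hz1, hz2⟩ :=
    ((eventually_gt_atTop y).and (hr.tendsto_atTop.eventually_gt_atTop (r y))).exists
  have hz : z ∈ Ici (0 : ℝ) := le_trans (mem_Ici.1 hy) hz1.le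
  have := hr.concaveOn.slope_anti_adjacent hx hz hxy hz1
  rw [heq, sub_self, zero_div] at this
  exact absurd this (not_le.2 (div_pos (by linarith) (by linarith)))

lemma nonneg (hr : IsRateFunction r) {p : ℝ} (hp : 0 ≤ p) : 0 ≤ r p := by
  rw [← hr.map_zero]
  exact hr.monotoneOn (mem_Ici.2 le_rfl) hp hp

lemma le_of_le (hr : IsRateFunction r) {p q : ℝ} (hp : 0 ≤ p) (hq : 0 ≤ q) (h : r p ≤ r q) :
    p ≤ q :=
  (hr.strictMonoOn.le_iff_le hp hq).1 h

lemma continuous_max (hr : IsRateFunction r) : Continuous fun x => r (max x 0) :=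
  hr.continuousOn.comp_continuous (by fun_prop) fun _ => mem_Ici.2 (le_max_right _ _)

/-- The inverse of the rate function on `[0, ∞)`, continuously extended to `ℝ`: the power needed
to transmit at a given rate. -/
lemma exists_inverse (hr : IsRateFunction r) :
    ∃ g : ℝ → ℝ, Continuous g ∧ Monotone g ∧ ∀ y, 0 ≤ y → 0 ≤ g y ∧ r (g y) = y := by
  -- `r` is extended by the identity to the negative half-line, and becomes a bijection of `ℝ`
  set R : ℝ → ℝ := fun x => r (max x 0) + min x 0 with hR
  have hcont : Continuous R := hr.continuous_max.add (by fun_prop)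
  have hmono : StrictMono R := by
    intro x y hxy
    rcases le_or_gt y 0 with hy | hy
    · simp only [hR, max_eq_right hy, max_eq_right (hxy.le.trans hy), min_eq_left hy,
        min_eq_left (hxy.le.trans hy)]
      linarith
    · have h1 : r (max x 0) < r (max y 0) :=
        hr.strictMonoOn (mem_Ici.2 (le_max_right _ _)) (mem_Ici.2 (le_max_right _ _)) (by
          rw [max_eq_left hy.le]; exact max_lt hxy hy)
      have h2 : min x 0 ≤ min y 0 := min_le_min_right _ hxy.le
      simp only [hR]; linarith
  have htop : Tendsto R atTop atTop := by
    refine hr.tendsto_atTop.congr' ?_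
    filter_upwards [eventually_ge_atTop 0] with x hx
    simp [hR, max_eq_left hx, min_eq_right hx]
  have hbot : Tendsto R atBot atBot := by
    refine tendsto_id.congr' ?_
    filter_upwards [eventually_le_atBot 0] with x hx
    simp [hR, max_eq_right hx, min_eq_left hx, hr.map_zero]
  have hsurj : Function.Surjective R := hcont.surjective htop hbot
  let e := hmono.orderIsoOfSurjective R hsurj
  have hR0 : R 0 = 0 := by simp [hR, hr.map_zero]
  refine ⟨e.symm, e.symm.continuous, e.symm.monotone, fun y hy => ?_⟩
  have h1 : R (e.symm y) = y := hmono.orderIsoOfSurjective_self_symm_apply R hsurj y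
  have h2 : 0 ≤ e.symm y := by
    rw [← hmono.le_iff_le, hR0, h1]; exact hy
  refine ⟨h2, ?_⟩
  simpa [hR, max_eq_left h2, min_eq_right h2] using h1

/-- Convexity of the inverse of `r`: a marginal cost `c P` of data at power `P`, which is
nonnegative and increasing. It is the right derivative of the inverse of `r` at `r P`; working
with it avoids the possibly infinite slope of `r` at `0`. -/
lemma exists_marginal_cost (hr : IsRateFunction r) :
    ∃ c : ℝ → ℝ, Monotone c ∧ (∀ P, 0 ≤ c P) ∧
      ∀ P q, 0 ≤ P → 0 ≤ q → P + c P * (r q - r P) ≤ q := by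
  set S : ℝ → Set ℝ := fun P => (fun q => (q - P) / (r q - r P)) '' Ioi P with hS
  have hpos : ∀ {P q}, 0 ≤ P → P < q → 0 < r q - r P := fun hP hq =>
    sub_pos.2 (hr.strictMonoOn hP (hP.trans hq.le) hq)
  have hne : ∀ P, (S P).Nonempty := fun P => (nonempty_Ioi).image _
  have hnn : ∀ P, 0 ≤ P → ∀ x ∈ S P, 0 ≤ x := by
    rintro P hP _ ⟨q, hq, rfl⟩
    exact div_nonneg (sub_nonneg.2 (mem_Ioi.1 hq).le) (hpos hP hq).le
  have hbdd : ∀ P, 0 ≤ P → BddBelow (S P) := fun P hP => ⟨0, fun x hx => hnn P hP x hx⟩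
  -- the slopes of the inverse of `r` increase
  have hslope : ∀ {a b d}, 0 ≤ a → a < b → b < d →
      (b - a) / (r b - r a) ≤ (d - b) / (r d - r b) := by
    intro a b d ha hab hbd
    have h := hr.concaveOn.slope_anti_adjacent (mem_Ici.2 ha)
      (mem_Ici.2 (ha.trans (hab.trans hbd).le)) hab hbd
    have h1 := hpos ha hab
    have h2 := hpos (ha.trans hab.le) hbd
    rw [div_le_div_iff₀ (by linarith) (by linarith)] at h
    rw [div_le_div_iff₀ h1 h2]
    linarith
  have hup : ∀ P q, 0 ≤ P → P < q → sInf (S P) * (r q - r P) ≤ q - P := by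
    intro P q hP hq
    have h := csInf_le (hbdd P hP) ⟨q, hq, rfl⟩
    rwa [le_div_iff₀ (hpos hP hq)] at h
  have hlow : ∀ q P, 0 ≤ q → q < P → (P - q) / (r P - r q) ≤ sInf (S P) := by
    intro q P hq hqP
    refine le_csInf (hne P) ?_
    rintro _ ⟨d, hd, rfl⟩
    exact hslope hq hqP hd
  refine ⟨fun P => sInf (S (max P 0)), ?_, ?_, ?_⟩
  · intro P Q hPQ
    rcases (max_le_max_right 0 hPQ).eq_or_lt with h | h
    · simp only [h]; exact le_rfl
    · refine le_trans ?_ (hlow _ _ (le_max_right P 0) h)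
      exact csInf_le (hbdd _ (le_max_right _ _)) ⟨_, h, rfl⟩
  · intro P
    exact le_csInf (hne _) (hnn _ (le_max_right _ _))
  · intro P q hP hq
    simp only [max_eq_left hP]
    rcases lt_trichotomy P q with h | h | h
    · have := hup P q hP h; linarith
    · simp [h]
    · have h1 := hlow q P hq h
      rw [div_le_iff₀ (hpos hq h)] at h1
      linarith

end IsRateFunction

/-! ### Piecewise continuous functions and power curves -/

namespace PiecewiseContinuousOn

variable {f g : ℝ → ℝ} {a b : ℝ}

lemma congr (hf : PiecewiseContinuousOn f a b) (h : ∀ t ∈ Icc a b, g t = f t) :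
    PiecewiseContinuousOn g a b := by
  obtain ⟨⟨S, hS, hc⟩, hR, hL⟩ := hf
  refine ⟨⟨S, hS, fun t ht => (hc t ht).congr h (h t ht.1)⟩, fun t ht => ?_, fun t ht => ?_⟩
  · obtain ⟨L, hL⟩ := hR t ht
    refine ⟨L, hL.congr' ?_⟩
    filter_upwards [Ioo_mem_nhdsGT ht.2] with s hs
    exact (h s ⟨ht.1.trans hs.1.le, hs.2.le⟩).symm
  · obtain ⟨L, hL⟩ := hL t ht
    refine ⟨L, hL.congr' ?_⟩
    filter_upwards [Ioo_mem_nhdsLT ht.1] with s hs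
    exact (h s ⟨hs.1.le, hs.2.le.trans ht.2⟩).symm

lemma comp₂ (hf : PiecewiseContinuousOn f a b) (hg : PiecewiseContinuousOn g a b)
    {φ : ℝ × ℝ → ℝ} (hφ : Continuous φ) :
    PiecewiseContinuousOn (fun t => φ (f t, g t)) a b := by
  obtain ⟨⟨S, hS, hc⟩, hR, hL⟩ := hf
  obtain ⟨⟨S', hS', hc'⟩, hR', hL'⟩ := hg
  refine ⟨⟨S ∪ S', hS.union hS', fun t ht => ?_⟩, fun t ht => ?_, fun t ht => ?_⟩
  · exact hφ.continuousAt.comp_continuousWithinAt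
      ((hc t ⟨ht.1, fun h => ht.2 (Or.inl h)⟩).prodMk (hc' t ⟨ht.1, fun h => ht.2 (Or.inr h)⟩))
  · obtain ⟨L, h⟩ := hR t ht
    obtain ⟨L', h'⟩ := hR' t ht
    exact ⟨φ (L, L'), (hφ.tendsto _).comp (h.prodMk_nhds h')⟩
  · obtain ⟨L, h⟩ := hL t ht
    obtain ⟨L', h'⟩ := hL' t ht
    exact ⟨φ (L, L'), (hφ.tendsto _).comp (h.prodMk_nhds h')⟩

lemma comp_continuous (hf : PiecewiseContinuousOn f a b) {φ : ℝ → ℝ} (hφ : Continuous φ) :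
    PiecewiseContinuousOn (fun t => φ (f t)) a b :=
  hf.comp₂ hf (φ := fun x => φ x.1) (by fun_prop)

lemma const (C : ℝ) : PiecewiseContinuousOn (fun _ => C) a b :=
  ⟨⟨∅, finite_empty, fun _ _ => continuousWithinAt_const⟩, fun _ _ => ⟨C, tendsto_const_nhds⟩,
    fun _ _ => ⟨C, tendsto_const_nhds⟩⟩

/-- Following `f` before time `x` and `g` from then on. -/
lemma splice (hf : PiecewiseContinuousOn f a b) (hg : PiecewiseContinuousOn g a b) (x : ℝ) :
    PiecewiseContinuousOn (fun t => if t < x then f t else g t) a b := by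
  obtain ⟨⟨S, hS, hc⟩, hR, hL⟩ := hf
  obtain ⟨⟨S', hS', hc'⟩, hR', hL'⟩ := hg
  refine ⟨⟨insert x (S ∪ S'), (hS.union hS').insert x, fun t ht => ?_⟩,
    fun t ht => ?_, fun t ht => ?_⟩
  · have ht1 : t ≠ x := fun h => ht.2 (Or.inl h)
    rcases lt_or_gt_of_ne ht1 with h | h
    · refine (hc t ⟨ht.1, fun h => ht.2 (Or.inr (Or.inl h))⟩).congr_of_eventuallyEq ?_ (by simp [h])
      filter_upwards [mem_nhdsWithin_of_mem_nhds (Iio_mem_nhds h)] with s hs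
      simp [mem_Iio.1 hs]
    · refine (hc' t ⟨ht.1, fun h => ht.2 (Or.inr (Or.inr h))⟩).congr_of_eventuallyEq ?_
        (by simp [h.le])
      filter_upwards [mem_nhdsWithin_of_mem_nhds (Ioi_mem_nhds h)] with s hs
      simp [(mem_Ioi.1 hs).le]
  · rcases lt_or_ge t x with h | h
    · obtain ⟨L, h'⟩ := hR t ht
      refine ⟨L, h'.congr' ?_⟩
      filter_upwards [mem_nhdsWithin_of_mem_nhds (Iio_mem_nhds h)] with s hs
      simp [mem_Iio.1 hs]
    · obtain ⟨L, h'⟩ := hR' t ht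
      refine ⟨L, h'.congr' ?_⟩
      filter_upwards [self_mem_nhdsWithin] with s hs
      simp [h.trans (mem_Ioi.1 hs).le]
  · rcases le_or_gt t x with h | h
    · obtain ⟨L, h'⟩ := hL t ht
      refine ⟨L, h'.congr' ?_⟩
      filter_upwards [self_mem_nhdsWithin] with s hs
      simp [(mem_Iio.1 hs).trans_le h]
    · obtain ⟨L, h'⟩ := hL' t ht
      refine ⟨L, h'.congr' ?_⟩
      filter_upwards [mem_nhdsWithin_of_mem_nhds (Ioi_mem_nhds h)] with s hs
      simp [(mem_Ioi.1 hs).le]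

lemma exists_bound (hf : PiecewiseContinuousOn f a b) : ∃ C, ∀ t ∈ Icc a b, |f t| ≤ C := by
  obtain ⟨-, hR, hL⟩ := hf
  refine isCompact_Icc.induction_on (p := fun A => ∃ C, ∀ t ∈ A, |f t| ≤ C)
    ⟨0, by simp⟩ (fun s t hst ⟨C, hC⟩ => ⟨C, fun x hx => hC x (hst hx)⟩) ?_ ?_
  · rintro s t ⟨C, hC⟩ ⟨C', hC'⟩
    exact ⟨max C C', fun x hx => hx.elim (fun h => (hC x h).trans (le_max_left _ _))
      fun h => (hC' x h).trans (le_max_right _ _)⟩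
  · intro x hx
    have h1 : ∃ C, ∀ᶠ s in 𝓝[>] x, s ∈ Icc a b → |f s| ≤ C := by
      rcases hx.2.eq_or_lt with h | h
      · refine ⟨0, ?_⟩
        filter_upwards [self_mem_nhdsWithin] with s hs hs'
        exact absurd (hs'.2.trans h.ge) (not_le.2 hs)
      · obtain ⟨L, hL⟩ := hR x ⟨hx.1, h⟩
        refine ⟨|L| + 1, ?_⟩
        filter_upwards [hL.abs.eventually (Iio_mem_nhds (lt_add_one |L|))] with s hs _
        exact (mem_Iio.1 hs).le
    have h2 : ∃ C, ∀ᶠ s in 𝓝[<] x, s ∈ Icc a b → |f s| ≤ C := by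
      rcases hx.1.eq_or_lt with h | h
      · refine ⟨0, ?_⟩
        filter_upwards [self_mem_nhdsWithin] with s hs hs'
        exact absurd (h.ge.trans hs'.1) (not_le.2 hs)
      · obtain ⟨L, hL⟩ := hL x ⟨h, hx.2⟩
        refine ⟨|L| + 1, ?_⟩
        filter_upwards [hL.abs.eventually (Iio_mem_nhds (lt_add_one |L|))] with s hs _
        exact (mem_Iio.1 hs).le
    obtain ⟨C1, h1⟩ := h1
    obtain ⟨C2, h2⟩ := h2
    set C := max |f x| (max C1 C2)
    have h3 : ∀ᶠ s in 𝓝 x, s ∈ Icc a b → |f s| ≤ C := by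
      rw [← nhdsNE_sup_pure, ← nhdsLT_sup_nhdsGT, eventually_sup, eventually_sup]
      refine ⟨⟨?_, ?_⟩, ?_⟩
      · filter_upwards [h2] with s hs hs'
        exact (hs hs').trans ((le_max_right _ _).trans (le_max_right _ _))
      · filter_upwards [h1] with s hs hs'
        exact (hs hs').trans ((le_max_left _ _).trans (le_max_right _ _))
      · exact fun _ => le_max_left _ _
    exact ⟨{s | |f s| ≤ C}, eventually_nhdsWithin_iff.2 h3, C, fun t ht => ht⟩

lemma aestronglyMeasurable (hf : PiecewiseContinuousOn f a b) :
    AEStronglyMeasurable f (volume.restrict (Icc a b)) := by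
  obtain ⟨⟨S, hS, hc⟩, -, -⟩ := hf
  have h1 : AEStronglyMeasurable f (volume.restrict (Icc a b \ S)) :=
    ContinuousOn.aestronglyMeasurable (fun t ht => (hc t ht).mono sdiff_subset)
      (measurableSet_Icc.diff hS.measurableSet)
  have h2 : (volume.restrict (Icc a b \ S)) = volume.restrict (Icc a b) :=
    Measure.restrict_congr_set (sdiff_null_ae_eq_self (hS.measure_zero _))
  rwa [h2] at h1

lemma intervalIntegrable (hf : PiecewiseContinuousOn f a b) {x y : ℝ} (hx : x ∈ Icc a b)
    (hy : y ∈ Icc a b) : IntervalIntegrable f volume x y := by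
  obtain ⟨C, hC⟩ := hf.exists_bound
  have h : IntegrableOn f (Icc a b) volume := by
    refine ⟨hf.aestronglyMeasurable, HasFiniteIntegral.of_bounded (C := C) ?_⟩
    filter_upwards [ae_restrict_mem measurableSet_Icc] with t ht
    exact hC t ht
  refine intervalIntegrable_iff.2 (h.mono_set ?_)
  exact uIoc_subset_uIcc.trans (uIcc_subset_Icc hx hy)

end PiecewiseContinuousOn

/-! ### Energy and data curves -/

/-- Energy is data sent at the rate `id`: `energyCurve p` is `dataCurve id p` by definition, so
facts about data curves apply to it. -/
lemma isRateFunction_id : IsRateFunction id where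
  continuousOn := continuousOn_id
  concaveOn := concaveOn_id (convex_Ici 0)
  monotoneOn := monotone_id.monotoneOn _
  tendsto_atTop := tendsto_id
  map_zero := rfl

/-- The policy that follows `p` before time `x` and `q` from time `x` on. -/
noncomputable def splice (x : ℝ) (p q : ℝ → ℝ) (t : ℝ) : ℝ := if t < x then p t else q t

lemma dataCurve_zero (r p : ℝ → ℝ) : dataCurve r p 0 = 0 := integral_same

lemma energyCurve_zero (p : ℝ → ℝ) : energyCurve p 0 = 0 := integral_same

namespace IsPowerCurve

variable {T : ℝ} {r p q : ℝ → ℝ}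

lemma rate (hp : IsPowerCurve T p) (hr : IsRateFunction r) :
    PiecewiseContinuousOn (fun t => r (p t)) 0 T :=
  (hp.piecewiseContinuousOn.comp_continuous hr.continuous_max).congr fun t ht => by
    rw [max_eq_left (hp.nonneg t ht)]

lemma const {P : ℝ} (hP : 0 ≤ P) : IsPowerCurve T fun _ => P :=
  ⟨fun _ _ => hP, .const P⟩

lemma splice (hp : IsPowerCurve T p) (hq : IsPowerCurve T q) (x : ℝ) :
    IsPowerCurve T (splice x p q) := by
  refine ⟨fun t ht => ?_, hp.piecewiseContinuousOn.splice hq.piecewiseContinuousOn x⟩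
  unfold TwoHop.splice
  split_ifs
  exacts [hp.nonneg t ht, hq.nonneg t ht]

lemma integrable_rate (hp : IsPowerCurve T p) (hr : IsRateFunction r) {x y : ℝ}
    (hx : x ∈ Icc 0 T) (hy : y ∈ Icc 0 T) :
    IntervalIntegrable (fun t => r (p t)) volume x y :=
  (hp.rate hr).intervalIntegrable hx hy

lemma integrable (hp : IsPowerCurve T p) {x y : ℝ} (hx : x ∈ Icc 0 T) (hy : y ∈ Icc 0 T) :
    IntervalIntegrable p volume x y :=
  hp.piecewiseContinuousOn.intervalIntegrable hx hy

lemma dataCurve_sub (hp : IsPowerCurve T p) (hr : IsRateFunction r) {x y : ℝ}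
    (hx : x ∈ Icc 0 T) (hy : y ∈ Icc 0 T) :
    dataCurve r p y - dataCurve r p x = ∫ s in x..y, r (p s) := by
  have h0 : (0 : ℝ) ∈ Icc 0 T := ⟨le_rfl, hx.1.trans hx.2⟩
  exact integral_interval_sub_left (hp.integrable_rate hr h0 hy) (hp.integrable_rate hr h0 hx)

lemma energyCurve_sub (hp : IsPowerCurve T p) {x y : ℝ}
    (hx : x ∈ Icc 0 T) (hy : y ∈ Icc 0 T) :
    energyCurve p y - energyCurve p x = ∫ s in x..y, p s :=
  hp.dataCurve_sub isRateFunction_id hx hy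

lemma dataCurve_monotoneOn (hp : IsPowerCurve T p) (hr : IsRateFunction r) :
    MonotoneOn (dataCurve r p) (Icc 0 T) := by
  intro x hx y hy hxy
  rw [← sub_nonneg, hp.dataCurve_sub hr hx hy]
  exact integral_nonneg hxy fun s hs =>
    hr.nonneg (hp.nonneg s ⟨hx.1.trans hs.1, hs.2.trans hy.2⟩)

lemma dataCurve_nonneg (hp : IsPowerCurve T p) (hr : IsRateFunction r) {t : ℝ}
    (ht : t ∈ Icc 0 T) : 0 ≤ dataCurve r p t := by
  have := hp.dataCurve_monotoneOn hr ⟨le_rfl, ht.1.trans ht.2⟩ ht ht.1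
  rwa [dataCurve_zero] at this

lemma dataCurve_continuousOn (hp : IsPowerCurve T p) (hr : IsRateFunction r) (hT : 0 ≤ T) :
    ContinuousOn (dataCurve r p) (Icc 0 T) := by
  have := continuousOn_primitive_interval' (hp.integrable_rate hr ⟨le_rfl, hT⟩ ⟨hT, le_rfl⟩)
    (left_mem_uIcc)
  rwa [uIcc_of_le hT] at this

lemma dataCurve_splice_of_le {x t : ℝ} (ht0 : 0 ≤ t) (htx : t ≤ x) :
    dataCurve r (TwoHop.splice x p q) t = dataCurve r p t := by
  unfold dataCurve
  refine integral_congr_ae ?_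
  filter_upwards [compl_mem_ae_iff.2 (measure_singleton x)] with s hs hs'
  rw [uIoc_of_le ht0] at hs'
  have : s < x := lt_of_le_of_ne (hs'.2.trans htx) hs
  simp [TwoHop.splice, this]

lemma dataCurve_splice_of_ge (hp : IsPowerCurve T p) (hq : IsPowerCurve T q)
    (hr : IsRateFunction r) {x t : ℝ} (hx : x ∈ Icc 0 T) (ht : t ∈ Icc 0 T) (hxt : x ≤ t) :
    dataCurve r (TwoHop.splice x p q) t =
      dataCurve r p x + (dataCurve r q t - dataCurve r q x) := by
  have h1 := (hp.splice hq x).dataCurve_sub hr hx ht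
  rw [dataCurve_splice_of_le hx.1 le_rfl] at h1
  have h2 : ∫ s in x..t, r (TwoHop.splice x p q s) = ∫ s in x..t, r (q s) := by
    refine integral_congr fun s hs => ?_
    rw [uIcc_of_le hxt] at hs
    simp [TwoHop.splice, not_lt.2 hs.1]
  rw [h2, ← hq.dataCurve_sub hr hx ht] at h1
  linarith

lemma energyCurve_splice_of_le {x t : ℝ} (ht0 : 0 ≤ t) (htx : t ≤ x) :
    energyCurve (TwoHop.splice x p q) t = energyCurve p t :=
  dataCurve_splice_of_le (r := id) ht0 htx

lemma energyCurve_splice_of_ge (hp : IsPowerCurve T p) (hq : IsPowerCurve T q)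
    {x t : ℝ} (hx : x ∈ Icc 0 T) (ht : t ∈ Icc 0 T) (hxt : x ≤ t) :
    energyCurve (TwoHop.splice x p q) t =
      energyCurve p x + (energyCurve q t - energyCurve q x) :=
  hp.dataCurve_splice_of_ge hq isRateFunction_id hx ht hxt

/-- Jensen's inequality with its error term: transmitting at the constant power `P` is the
cheapest way of sending `r P * (y - x)` in `[x, y]`, and surplus data costs at least the
marginal cost `c` each. -/
lemma jensen (hp : IsPowerCurve T p) (hr : IsRateFunction r) {P c x y : ℝ}
    (hc : ∀ q, 0 ≤ q → P + c * (r q - r P) ≤ q)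
    (hx : x ∈ Icc 0 T) (hy : y ∈ Icc 0 T) (hxy : x ≤ y) :
    P * (y - x) + c * (dataCurve r p y - dataCurve r p x - r P * (y - x)) ≤
      energyCurve p y - energyCurve p x := by
  rw [hp.dataCurve_sub hr hx hy, hp.energyCurve_sub hx hy]
  have hi := hp.integrable_rate hr hx hy
  have hd : IntervalIntegrable (fun s => c * (r (p s) - r P)) volume x y :=
    (hi.sub intervalIntegrable_const).const_mul c
  have h := integral_mono_on hxy (intervalIntegrable_const.add hd) (hp.integrable hx hy)
    (f := fun s => P + c * (r (p s) - r P)) fun s hs =>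
      hc (p s) (hp.nonneg s ⟨hx.1.trans hs.1, hs.2.trans hy.2⟩)
  refine le_trans (le_of_eq ?_) h
  rw [integral_add intervalIntegrable_const hd, intervalIntegral.integral_const_mul,
    integral_sub hi intervalIntegrable_const]
  simp only [intervalIntegral.integral_const, smul_eq_mul]
  ring

lemma energyCurve_pos (hp : IsPowerCurve T p) (hr : IsRateFunction r) {t : ℝ}
    (ht : t ∈ Icc 0 T) (h : 0 < dataCurve r p t) : 0 < energyCurve p t := by
  have h0 : (0 : ℝ) ∈ Icc 0 T := ⟨le_rfl, ht.1.trans ht.2⟩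
  have ht0 : 0 < t := lt_of_le_of_ne ht.1 fun h' => by
    rw [← h', dataCurve_zero] at h; exact lt_irrefl _ h
  obtain ⟨g, -, -, hg⟩ := hr.exists_inverse
  obtain ⟨c, -, -, hc⟩ := hr.exists_marginal_cost
  obtain ⟨hP, hrP⟩ := hg (dataCurve r p t / t) (by positivity)
  set P := g (dataCurve r p t / t)
  have h1 := hp.jensen hr (fun q hq => hc P q hP hq) h0 ht ht.1
  have hP' : 0 < P := lt_of_le_of_ne hP fun h' => by
    rw [← h', hr.map_zero] at hrP
    exact absurd hrP (by positivity)
  have h2 : r P * (t - 0) = dataCurve r p t := by rw [hrP]; field_simp; ring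
  rw [h2, dataCurve_zero, energyCurve_zero] at h1
  have : 0 < P * t := mul_pos hP' ht0
  linarith

end IsPowerCurve

/-! ### Comparison with an increasing power curve -/

/-- Second mean value inequality: if `c ≥ 0` is increasing and `∫ v ≥ 0` over `[x, b]` for
`x = a` and for all points of increase `x` of `c`, then `∫ c * v ≥ 0`. By the layer cake formula
`∫ c * v` is a superposition of the integrals of `v` over the sets `{c > y}`, and these are
intervals `[x, b]` of this kind. -/
lemma integral_monotone_mul_nonneg {c v : ℝ → ℝ} {a b : ℝ} (hab : a ≤ b) (hc : Monotone c)
    (hc0 : ∀ s, 0 ≤ c s) (hv : IntervalIntegrable v volume a b) (h0 : 0 ≤ ∫ s in a..b, v s)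
    (h : ∀ x ∈ Ioo a b, 0 ≤ ∫ s in x..b, v s ∨ ∀ᶠ s in 𝓝 x, c s = c x) :
    0 ≤ ∫ s in a..b, c s * v s := by
  have hv' : IntegrableOn v (Ioc a b) := (intervalIntegrable_iff_integrableOn_Ioc_of_le hab).1 hv
  set D : Set (ℝ × ℝ) := {z | z.2 < c z.1}
  have hD : MeasurableSet D := measurableSet_lt measurable_snd (hc.measurable.comp measurable_fst)
  have hint : Integrable (Function.uncurry fun s y => (Iio (c s)).indicator (fun _ => v s) y)
      ((volume.restrict (Ioc a b)).prod (volume.restrict (Ioc 0 (c b)))) := by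
    have h1 := (Integrable.mul_prod hv' (integrable_const (1 : ℝ)
      (μ := volume.restrict (Ioc 0 (c b))))).indicator hD
    refine h1.congr (Eventually.of_forall fun z => ?_)
    by_cases hz : z.2 < c z.1
    · simp [Function.uncurry, indicator, D, hz]
    · simp [Function.uncurry, indicator, D, hz]
  have hlayer : ∫ s in a..b, c s * v s =
      ∫ s in Ioc a b, ∫ y in Ioc 0 (c b), (Iio (c s)).indicator (fun _ => v s) y := by
    rw [integral_of_le hab]
    refine setIntegral_congr_fun measurableSet_Ioc fun s hs => ?_
    have h1 : Ioc 0 (c b) ∩ Iio (c s) = Ioo 0 (c s) := by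
      ext y
      simp only [mem_inter_iff, mem_Ioc, mem_Iio, mem_Ioo]
      exact ⟨fun h => ⟨h.1.1, h.2⟩, fun h => ⟨⟨h.1, h.2.le.trans (hc hs.2)⟩, h.2⟩⟩
    rw [setIntegral_indicator measurableSet_Iio, h1, setIntegral_const]
    simp [Measure.real, hc0 s]
  rw [hlayer, integral_integral_swap hint]
  refine integral_nonneg fun y => ?_
  set A : Set ℝ := {s ∈ Ioc a b | y < c s} with hA
  have h2 : (∫ s in Ioc a b, (Iio (c s)).indicator (fun _ => v s) y) = ∫ s in A, v s := by
    have hm : MeasurableSet {s | y < c s} := measurableSet_lt measurable_const hc.measurable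
    have : A = Ioc a b ∩ {s | y < c s} := rfl
    rw [this, ← setIntegral_indicator hm]
    rfl
  simp only [Pi.zero_apply]
  rw [h2]
  rcases A.eq_empty_or_nonempty with he | hne
  · simp [he]
  have hbdd : BddBelow A := ⟨a, fun s hs => hs.1.1.le⟩
  set x := sInf A with hx
  have hxa : a ≤ x := le_csInf hne fun s hs => hs.1.1.le
  have hxb : x ≤ b := by
    obtain ⟨s, hs⟩ := hne
    exact (csInf_le hbdd hs).trans hs.1.2
  have h3 : ∫ s in A, v s = ∫ s in x..b, v s := by
    rw [integral_of_le hxb]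
    refine setIntegral_congr_set ?_
    filter_upwards [compl_mem_ae_iff.2 (measure_singleton x)] with s hs
    refine propext ⟨fun h' => ⟨lt_of_le_of_ne (csInf_le hbdd h') (Ne.symm hs), h'.1.2⟩,
      fun h' => ?_⟩
    obtain ⟨s', hs', hlt⟩ := (csInf_lt_iff hbdd hne).1 h'.1
    exact ⟨⟨hxa.trans_lt h'.1, h'.2⟩, hs'.2.trans_le (hc hlt.le)⟩
  rw [h3]
  rcases hxa.eq_or_lt with h4 | h4
  · rw [← h4]; exact h0
  rcases hxb.eq_or_lt with h5 | h5
  · rw [h5]; simp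
  rcases h x ⟨h4, h5⟩ with h6 | h6
  · exact h6
  exfalso
  obtain ⟨ε, hε, hball⟩ := Metric.eventually_nhds_iff.1 h6
  obtain ⟨s', hs', hlt⟩ := (csInf_lt_iff hbdd hne).1 (lt_add_of_pos_right x hε)
  have h7 : c s' = c x := hball (by
    rw [Real.dist_eq, abs_of_nonneg (sub_nonneg.2 (csInf_le hbdd hs'))]
    linarith)
  set s := max ((a + x) / 2) (x - ε / 2) with hs
  have h8 : s < x := max_lt (by linarith) (by linarith)
  have h9 : x - ε / 2 ≤ s := le_max_right _ _
  have h10 : a < s := lt_of_lt_of_le (by linarith) (le_max_left _ _)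
  have h11 : c s = c x := hball (by rw [Real.dist_eq, abs_lt]; constructor <;> linarith)
  have h12 : s ∈ A := ⟨⟨h10, h8.le.trans hxb⟩, by rw [h11, ← h7]; exact hs'.2⟩
  exact absurd (csInf_le hbdd h12) (not_le.2 h8)

/-- A policy `q` with increasing power, hence convex data curve, costs no more than `p` in
`[a, b]` if `p` sends at least as much data in `[a, b]`, and in `[x, b]` for each `x` around which
`q` is not constant: `c (q s)`, with `c` the marginal cost, is an increasing Lagrange multiplier
for the constraints on the amounts of data sent in the intervals `[x, b]`. -/
lemma energyCurve_sub_le_of_monotoneOn {T : ℝ} {r p q : ℝ → ℝ} (hr : IsRateFunction r)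
    (hp : IsPowerCurve T p) (hq : IsPowerCurve T q) {a b : ℝ} (ha : a ∈ Icc 0 T)
    (hb : b ∈ Icc 0 T) (hab : a ≤ b) (hmono : MonotoneOn q (Icc a b))
    (h0 : dataCurve r q b - dataCurve r q a ≤ dataCurve r p b - dataCurve r p a)
    (h : ∀ x ∈ Ioo a b,
      dataCurve r q b - dataCurve r q x ≤ dataCurve r p b - dataCurve r p x ∨
        ∀ᶠ s in 𝓝 x, q s = q x) :
    energyCurve q b - energyCurve q a ≤ energyCurve p b - energyCurve p a := by
  obtain ⟨c, hcm, hc0, hc⟩ := hr.exists_marginal_cost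
  -- `clamp` maps `ℝ` to `[a, b]`, so that the multiplier is monotone on all of `ℝ`
  set clamp : ℝ → ℝ := fun s => max a (min b s) with hcl
  have hclm : Monotone clamp := fun s t hst => max_le_max_left _ (min_le_min_left _ hst)
  have hclI : ∀ s, clamp s ∈ Icc a b := fun s => ⟨le_max_left _ _, max_le hab (min_le_left _ _)⟩
  have hcle : ∀ s ∈ Icc a b, clamp s = s := fun s hs => by
    simp [hcl, min_eq_right hs.2, max_eq_right hs.1]
  have hsub : Icc a b ⊆ Icc 0 T := fun s hs => ⟨ha.1.trans hs.1, hs.2.trans hb.2⟩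
  have hvi : ∀ {x y}, x ∈ Icc 0 T → y ∈ Icc 0 T →
      IntervalIntegrable (fun s => r (p s) - r (q s)) volume x y := fun hx hy =>
    (hp.integrable_rate hr hx hy).sub (hq.integrable_rate hr hx hy)
  have hv : ∀ {x}, x ∈ Icc 0 T → ∫ s in x..b, (r (p s) - r (q s)) =
      (dataCurve r p b - dataCurve r p x) - (dataCurve r q b - dataCurve r q x) := by
    intro x hx
    rw [integral_sub (hp.integrable_rate hr hx hb) (hq.integrable_rate hr hx hb),
      hp.dataCurve_sub hr hx hb, hq.dataCurve_sub hr hx hb]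
  have hm : Monotone fun s => c (q (clamp s)) := fun s t hst =>
    hcm (hmono (hclI s) (hclI t) (hclm hst))
  have key := integral_monotone_mul_nonneg hab hm (fun s => hc0 _) (hvi ha hb)
    (by rw [hv ha]; linarith) (by
      intro x hx
      refine (h x hx).imp (fun h' => by rw [hv (hsub ⟨hx.1.le, hx.2.le⟩)]; linarith) fun h' => ?_
      filter_upwards [h', Icc_mem_nhds hx.1 hx.2] with s hs hs'
      rw [hcle s hs', hcle x ⟨hx.1.le, hx.2.le⟩, hs])
  have hbd : IntervalIntegrable (fun s => c (q (clamp s)) * (r (p s) - r (q s))) volume a b := by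
    rw [intervalIntegrable_iff_integrableOn_Ioc_of_le hab]
    refine Integrable.bdd_mul (c := c (q b))
      ((intervalIntegrable_iff_integrableOn_Ioc_of_le hab).1 (hvi ha hb))
      hm.measurable.aestronglyMeasurable ?_
    refine Eventually.of_forall fun s => ?_
    rw [Real.norm_eq_abs, abs_of_nonneg (hc0 _)]
    exact hcm (hmono (hclI s) ⟨hab, le_rfl⟩ (hclI s).2)
  have h1 := integral_mono_on hab hbd ((hp.integrable ha hb).sub (hq.integrable ha hb))
    fun s hs => by
      have := hc (q s) (p s) (hq.nonneg s (hsub hs)) (hp.nonneg s (hsub hs))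
      rw [hcle s hs]
      linarith
  rw [integral_sub (hp.integrable ha hb) (hq.integrable ha hb), ← hp.energyCurve_sub ha hb,
    ← hq.energyCurve_sub ha hb] at h1
  linarith

/-! ### Convex minorants -/

/-- The greatest convex minorant of `k` on `S`, provided `k` has a convex minorant on `S`. -/
noncomputable def convexMinorant (S : Set ℝ) (k : ℝ → ℝ) (t : ℝ) : ℝ :=
  sSup {y | ∃ φ : ℝ → ℝ, ConvexOn ℝ S φ ∧ (∀ s ∈ S, φ s ≤ k s) ∧ φ t = y}

section convexMinorant

variable {S : Set ℝ} {k φ : ℝ → ℝ}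

lemma le_convexMinorant (hφ : ConvexOn ℝ S φ) (h : ∀ s ∈ S, φ s ≤ k s) {t : ℝ} (ht : t ∈ S) :
    φ t ≤ convexMinorant S k t := by
  refine le_csSup ⟨k t, ?_⟩ ⟨φ, hφ, h, rfl⟩
  rintro _ ⟨ψ, -, h, rfl⟩
  exact h t ht

lemma convexMinorant_le (hφ : ConvexOn ℝ S φ) (h : ∀ s ∈ S, φ s ≤ k s) {t : ℝ} (ht : t ∈ S) :
    convexMinorant S k t ≤ k t := by
  refine csSup_le ⟨φ t, φ, hφ, h, rfl⟩ ?_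
  rintro _ ⟨ψ, -, h, rfl⟩
  exact h t ht

lemma convexOn_convexMinorant (hφ : ConvexOn ℝ S φ) (h : ∀ s ∈ S, φ s ≤ k s) :
    ConvexOn ℝ S (convexMinorant S k) := by
  refine ⟨hφ.1, fun x hx y hy a b ha hb hab => ?_⟩
  refine csSup_le ⟨_, φ, hφ, h, rfl⟩ ?_
  rintro _ ⟨ψ, hψ, hle, rfl⟩
  refine (hψ.2 hx hy ha hb hab).trans (add_le_add ?_ ?_)
  · exact mul_le_mul_of_nonneg_left (le_convexMinorant hψ hle hx) ha
  · exact mul_le_mul_of_nonneg_left (le_convexMinorant hψ hle hy) hb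

/-- A convex function lies below a chord between its end points and above it elsewhere. -/
lemma chord_bounds {f : ℝ → ℝ} (hf : ConvexOn ℝ S f) {a b t : ℝ} (ha : a ∈ S) (hb : b ∈ S)
    (ht : t ∈ S) (hab : a < b) :
    (t ∈ Icc a b → f t ≤ f a + (f b - f a) / (b - a) * (t - a)) ∧
      (t ∉ Icc a b → f a + (f b - f a) / (b - a) * (t - a) ≤ f t) := by
  have hba : 0 < b - a := sub_pos.2 hab
  rcases lt_trichotomy t a with h | h | h
  · refine ⟨fun h' => absurd h'.1 (not_le.2 h), fun _ => ?_⟩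
    have h1 := hf.slope_mono_adjacent ht hb h hab
    rw [div_le_iff₀ (by linarith)] at h1
    linarith
  · simp [h]
  rcases lt_trichotomy t b with h' | h' | h'
  · refine ⟨fun _ => ?_, fun h2 => absurd ⟨h.le, h'.le⟩ h2⟩
    have h1 := hf.secant_mono ha ht hb h.ne' hab.ne' h'.le
    rw [div_le_iff₀ (by linarith)] at h1
    linarith
  · subst h'
    rw [div_mul_cancel₀ _ hba.ne']
    simp
  · refine ⟨fun h2 => absurd h2.2 (not_le.2 h'), fun _ => ?_⟩
    have h1 := hf.secant_mono ha hb ht hab.ne' h.ne' h'.le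
    rw [le_div_iff₀ (by linarith)] at h1
    linarith

lemma convexOn_affine (hS : Convex ℝ S) (A m a : ℝ) : ConvexOn ℝ S fun t => A + m * (t - a) := by
  refine ⟨hS, fun x _ y _ α β _ _ hab => le_of_eq ?_⟩
  have : β = 1 - α := by linarith
  subst this
  simp only [smul_eq_mul]
  ring

/-- The greatest convex minorant is affine around each point where it is below `k`: otherwise it
could be raised to a short chord. -/
lemma convexMinorant_eventually_affine (hφ : ConvexOn ℝ S φ) (h : ∀ s ∈ S, φ s ≤ k s) {x : ℝ}
    (hx : S ∈ 𝓝 x) (hk : ContinuousAt k x) (hlt : convexMinorant S k x < k x) :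
    ∃ A m a, ∀ᶠ s in 𝓝 x, convexMinorant S k s = A + m * (s - a) := by
  set κ := convexMinorant S k
  have hκ : ConvexOn ℝ S κ := convexOn_convexMinorant hφ h
  have hκc : ContinuousAt κ x :=
    hκ.continuousOn_interior.continuousAt
      (isOpen_interior.mem_nhds (mem_interior_iff_mem_nhds.2 hx))
  obtain ⟨v, hv1, hv2⟩ := exists_between hlt
  have hxS : ∀ᶠ s in 𝓝 x, s ∈ S := hx
  obtain ⟨δ, hδ, hball⟩ := Metric.eventually_nhds_iff.1
    (hxS.and ((hκc.eventually (Iio_mem_nhds hv1)).and (hk.eventually (Ioi_mem_nhds hv2))))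
  set a := x - δ / 2 with ha
  set b := x + δ / 2 with hb
  have hab : a < b := by simp only [ha, hb]; linarith
  have hJ : ∀ s ∈ Icc a b, s ∈ S ∧ κ s < v ∧ v < k s := fun s hs => hball (by
    rw [Real.dist_eq, abs_lt]
    constructor <;> linarith [hs.1, hs.2])
  have haJ := hJ a ⟨le_rfl, hab.le⟩
  have hbJ := hJ b ⟨hab.le, le_rfl⟩
  set L : ℝ → ℝ := fun t => κ a + (κ b - κ a) / (b - a) * (t - a) with hL
  have hchord : ∀ t ∈ S, (t ∈ Icc a b → κ t ≤ L t) ∧ (t ∉ Icc a b → L t ≤ κ t) := fun t ht =>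
    chord_bounds hκ haJ.1 hbJ.1 ht hab
  have hLv : ∀ t ∈ Icc a b, L t ≤ v := by
    intro t ht
    have hba : 0 < b - a := sub_pos.2 hab
    have h1 : L t = κ a * ((b - t) / (b - a)) + κ b * ((t - a) / (b - a)) := by
      simp only [hL]; field_simp; ring
    have h2 : v = v * ((b - t) / (b - a)) + v * ((t - a) / (b - a)) := by field_simp; ring
    rw [h1, h2]
    exact add_le_add
      (mul_le_mul_of_nonneg_right haJ.2.1.le (div_nonneg (by linarith [ht.2]) hba.le))
      (mul_le_mul_of_nonneg_right hbJ.2.1.le (div_nonneg (by linarith [ht.1]) hba.le))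
  have hsup : ConvexOn ℝ S (κ ⊔ L) := hκ.sup (convexOn_affine hφ.1 _ _ _)
  have hle : ∀ s ∈ S, (κ ⊔ L) s ≤ k s := by
    intro s hs
    refine sup_le (convexMinorant_le hφ h hs) ?_
    by_cases hsJ : s ∈ Icc a b
    · exact (hLv s hsJ).trans (hJ s hsJ).2.2.le
    · exact ((hchord s hs).2 hsJ).trans (convexMinorant_le hφ h hs)
  refine ⟨κ a, (κ b - κ a) / (b - a), a, ?_⟩
  filter_upwards [Icc_mem_nhds (show a < x by linarith) (show x < b by linarith)] with s hs
  refine le_antisymm ((hchord s (hJ s hs).1).1 hs) ?_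
  exact (le_max_right _ _).trans (le_convexMinorant hsup hle (hJ s hs).1)

lemma convexMinorant_deriv_eventually_const (hφ : ConvexOn ℝ S φ) (h : ∀ s ∈ S, φ s ≤ k s) {x : ℝ}
    (hx : S ∈ 𝓝 x) (hk : ContinuousAt k x) (hlt : convexMinorant S k x < k x) :
    ∃ m, ∀ᶠ s in 𝓝 x, derivWithin (convexMinorant S k) (Ioi s) s = m := by
  obtain ⟨A, m, a, hA⟩ := convexMinorant_eventually_affine hφ h hx hk hlt
  refine ⟨m, ?_⟩
  filter_upwards [hA.eventually_nhds] with s hs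
  have h1 : HasDerivAt (fun s => A + m * (s - a)) m s := by
    simpa using (((hasDerivAt_id s).sub_const a).const_mul m).const_add A
  exact ((h1.congr_of_eventuallyEq hs).hasDerivWithinAt).derivWithin
    (uniqueDiffWithinAt_Ioi s)

/-- Where the greatest convex minorant touches `k` and `k` is differentiable, its right derivative
is continuous: nearby slopes of the minorant are squeezed by slopes of `k`. -/
lemma convexMinorant_deriv_continuousAt (hφ : ConvexOn ℝ S φ) (h : ∀ s ∈ S, φ s ≤ k s) {x d : ℝ}
    (hx : S ∈ 𝓝 x) (hk : HasDerivAt k d x) (heq : convexMinorant S k x = k x) :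
    ContinuousAt (fun s => derivWithin (convexMinorant S k) (Ioi s) s) x := by
  set κ := convexMinorant S k
  have hκ : ConvexOn ℝ S κ := convexOn_convexMinorant hφ h
  have hκk : ∀ s ∈ S, κ s ≤ k s := fun s hs => convexMinorant_le hφ h hs
  have hκc : ContinuousAt κ x :=
    hκ.continuousOn_interior.continuousAt
      (isOpen_interior.mem_nhds (mem_interior_iff_mem_nhds.2 hx))
  have hint : ∀ᶠ s in 𝓝 x, s ∈ interior S :=
    isOpen_interior.mem_nhds (mem_interior_iff_mem_nhds.2 hx)
  have hxS : ∀ᶠ s in 𝓝 x, s ∈ S := hx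
  have hslope := hasDerivAt_iff_tendsto_slope.1 hk
  have hup : ∀ v, d < v → ∀ᶠ s in 𝓝 x, derivWithin κ (Ioi s) s < v := by
    intro v hv
    have h1 : ∀ᶠ y in 𝓝[>] x, slope k x y < v ∧ y ∈ S ∧ x < y :=
      ((hslope.mono_left (nhdsWithin_mono _ fun y hy => ne_of_gt hy)).eventually
        (Iio_mem_nhds hv)).and ((hxS.filter_mono nhdsWithin_le_nhds).and self_mem_nhdsWithin)
    obtain ⟨y, hy1, hyS, hxy⟩ := h1.exists
    have h2 : (κ y - κ x) / (y - x) < v := by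
      refine lt_of_le_of_lt ?_ hy1
      rw [slope_def_field, heq]
      exact div_le_div_of_nonneg_right (by linarith [hκk y hyS]) (by linarith)
    have h3 : ContinuousAt (fun s => (κ y - κ s) / (y - s)) x :=
      (continuousAt_const.sub hκc).div (by fun_prop) (by linarith)
    filter_upwards [h3.eventually (Iio_mem_nhds h2), Iio_mem_nhds hxy, hint] with s hs1 hs2 hs3
    refine lt_of_le_of_lt (hκ.rightDeriv_le_slope_of_mem_interior hs3 hyS hs2) ?_
    rw [slope_def_field]
    exact hs1
  have hlow : ∀ v, v < d → ∀ᶠ s in 𝓝 x, v < derivWithin κ (Ioi s) s := by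
    intro v hv
    have h1 : ∀ᶠ y in 𝓝[<] x, v < slope k x y ∧ y ∈ S ∧ y < x :=
      ((hslope.mono_left (nhdsWithin_mono _ fun y hy => ne_of_lt hy)).eventually
        (Ioi_mem_nhds hv)).and ((hxS.filter_mono nhdsWithin_le_nhds).and self_mem_nhdsWithin)
    obtain ⟨y, hy1, hyS, hxy⟩ := h1.exists
    have h2 : v < (κ x - κ y) / (x - y) := by
      refine lt_of_lt_of_le hy1 ?_
      rw [slope_comm, slope_def_field, heq]
      exact div_le_div_of_nonneg_right (by linarith [hκk y hyS]) (by linarith)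
    have h3 : ContinuousAt (fun s => (κ s - κ y) / (s - y)) x :=
      (hκc.sub continuousAt_const).div (by fun_prop) (by linarith)
    filter_upwards [h3.eventually (Ioi_mem_nhds h2), Ioi_mem_nhds hxy, hint] with s hs1 hs2 hs3
    refine lt_of_lt_of_le ?_ ((hκ.slope_le_leftDeriv_of_mem_interior hyS hs3 hs2).trans
      (hκ.leftDeriv_le_rightDeriv_of_mem_interior hs3))
    rw [slope_def_field]
    exact hs1
  exact continuousAt_of_tendsto_nhds (tendsto_order.2 ⟨hlow, hup⟩)

end convexMinorant

/-! ### Convexification of policies -/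

namespace IsPowerCurve

variable {T : ℝ} {r p : ℝ → ℝ}

/-- Outside a finite set the data curve is differentiable. -/
lemma exists_finite_hasDerivAt (hp : IsPowerCurve T p) (hr : IsRateFunction r) :
    ∃ S : Set ℝ, S.Finite ∧ ∀ t ∈ Ioo 0 T \ S, HasDerivAt (dataCurve r p) (r (p t)) t := by
  have hrate := hp.rate hr
  obtain ⟨S, hS, hc⟩ := hrate.1
  refine ⟨S, hS, fun t ht => ?_⟩
  have hI := Icc_mem_nhds ht.1.1 ht.1.2
  refine integral_hasDerivAt_right
    (hp.integrable_rate hr ⟨le_rfl, (ht.1.1.trans ht.1.2).le⟩ ⟨ht.1.1.le, ht.1.2.le⟩)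
    ⟨Icc 0 T, hI, hrate.aestronglyMeasurable⟩ ?_
  exact (hc t ⟨⟨ht.1.1.le, ht.1.2.le⟩, ht.2⟩).continuousAt hI

/-- Every policy can be replaced by one with increasing power whose data curve is the greatest
convex minorant of the original one: at each time it has sent no more data and has used no more
energy, and it sends the same amount of data in total. -/
theorem exists_convexification (hT : 0 < T) (hr : IsRateFunction r) (hp : IsPowerCurve T p) :
    ∃ q, IsPowerCurve T q ∧ MonotoneOn q (Icc 0 T) ∧ ConvexOn ℝ (Icc 0 T) (dataCurve r q) ∧
      (∀ t ∈ Icc 0 T, dataCurve r q t ≤ dataCurve r p t) ∧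
      dataCurve r q T = dataCurve r p T ∧
      (∀ t ∈ Icc 0 T, energyCurve q t ≤ energyCurve p t) ∧
      ∀ φ : ℝ → ℝ, ConvexOn ℝ (Icc 0 T) φ → (∀ t ∈ Icc 0 T, φ t ≤ dataCurve r p t) →
        ∀ t ∈ Icc 0 T, φ t ≤ dataCurve r q t := by
  set k := dataCurve r p with hkdef
  have h0I : (0 : ℝ) ∈ Icc 0 T := ⟨le_rfl, hT.le⟩
  have hTI : T ∈ Icc 0 T := ⟨hT.le, le_rfl⟩
  have hk0 : k 0 = 0 := dataCurve_zero r p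
  have hkc : ContinuousOn k (Icc 0 T) := hp.dataCurve_continuousOn hr hT.le
  have hz : ConvexOn ℝ (Icc 0 T) fun _ => (0 : ℝ) := convexOn_const 0 (convex_Icc 0 T)
  have hzk : ∀ s ∈ Icc 0 T, (0 : ℝ) ≤ k s := fun s hs => hp.dataCurve_nonneg hr hs
  set κ := convexMinorant (Icc 0 T) k with hκdef
  have hκ : ConvexOn ℝ (Icc 0 T) κ := convexOn_convexMinorant hz hzk
  have hκk : ∀ t ∈ Icc 0 T, κ t ≤ k t := fun t ht => convexMinorant_le hz hzk ht
  have hκnn : ∀ t ∈ Icc 0 T, 0 ≤ κ t := fun t ht => le_convexMinorant hz hzk ht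
  have hκ0 : κ 0 = 0 := le_antisymm ((hκk 0 h0I).trans hk0.le) (hκnn 0 h0I)
  -- the rate is bounded by `M`, so the line of slope `M` through `(T, k T)` is below `k`
  obtain ⟨M, hM⟩ := (hp.rate hr).exists_bound
  have hM0 : 0 ≤ M := (abs_nonneg _).trans (hM 0 h0I)
  have hlineT : ∀ t ∈ Icc 0 T, k T + M * (t - T) ≤ k t := by
    intro t ht
    have h1 := integral_mono_on ht.2 (hp.integrable_rate hr ht hTI) intervalIntegrable_const
      (g := fun _ => M) fun s hs => (le_abs_self _).trans (hM s ⟨ht.1.trans hs.1, hs.2⟩)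
    rw [← hp.dataCurve_sub hr ht hTI] at h1
    simp only [intervalIntegral.integral_const, smul_eq_mul] at h1
    linarith
  have hκline : ∀ t ∈ Icc 0 T, k T + M * (t - T) ≤ κ t := fun t ht =>
    le_convexMinorant (convexOn_affine (convex_Icc 0 T) (k T) M T) hlineT ht
  have hκT : κ T = k T := by
    refine le_antisymm (hκk T hTI) ?_
    simpa using hκline T hTI
  have hκc : ContinuousOn κ (Icc 0 T) := by
    intro t ht
    rcases ht.1.eq_or_lt with h | h
    · subst h
      refine tendsto_of_tendsto_of_tendsto_of_le_of_le' (g := fun _ => 0) (h := k) ?_ ?_ ?_ ?_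
      · rw [hκ0]; exact tendsto_const_nhds
      · rw [hκ0.trans hk0.symm]; exact hkc 0 h0I
      · filter_upwards [self_mem_nhdsWithin] with s hs using hκnn s hs
      · filter_upwards [self_mem_nhdsWithin] with s hs using hκk s hs
    rcases ht.2.eq_or_lt with h' | h'
    · subst h'
      refine tendsto_of_tendsto_of_tendsto_of_le_of_le' (g := fun s => k t + M * (s - t)) (h := k)
        ?_ ?_ ?_ ?_
      · rw [hκT]
        have : ContinuousWithinAt (fun s => k t + M * (s - t)) (Icc 0 t) t := by fun_prop
        simpa [ContinuousWithinAt] using this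
      · rw [hκT]; exact hkc t hTI
      · filter_upwards [self_mem_nhdsWithin] with s hs using hκline s hs
      · filter_upwards [self_mem_nhdsWithin] with s hs using hκk s hs
    · have h1 : t ∈ interior (Icc 0 T) := by rw [interior_Icc]; exact ⟨h, h'⟩
      exact (hκ.continuousOn_interior.continuousAt
        (isOpen_interior.mem_nhds h1)).continuousWithinAt
  -- the rate of the new policy
  set σ : ℝ → ℝ := fun t => if t ≤ 0 then 0 else if T ≤ t then M else derivWithin κ (Ioi t) t
    with hσ
  have hint : ∀ t ∈ Ioo 0 T, t ∈ interior (Icc 0 T) := fun t ht => by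
    rw [interior_Icc]; exact ht
  have hd0 : ∀ t ∈ Ioo 0 T, 0 ≤ derivWithin κ (Ioi t) t := by
    intro t ht
    refine le_trans ?_ ((hκ.slope_le_leftDeriv_of_mem_interior h0I (hint t ht) ht.1).trans
      (hκ.leftDeriv_le_rightDeriv_of_mem_interior (hint t ht)))
    rw [slope_def_field, hκ0, sub_zero, sub_zero]
    exact div_nonneg (hκnn t ⟨ht.1.le, ht.2.le⟩) ht.1.le
  have hdM : ∀ t ∈ Ioo 0 T, derivWithin κ (Ioi t) t ≤ M := by
    intro t ht
    refine (hκ.rightDeriv_le_slope_of_mem_interior (hint t ht) hTI ht.2).trans ?_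
    rw [slope_def_field, div_le_iff₀ (sub_pos.2 ht.2), hκT]
    linarith [hκline t ⟨ht.1.le, ht.2.le⟩]
  have hσI : ∀ t ∈ Ioo 0 T, σ t = derivWithin κ (Ioi t) t := fun t ht => by
    simp [hσ, not_le.2 ht.1, not_le.2 ht.2]
  have hσ0 : ∀ t, 0 ≤ σ t := by
    intro t
    simp only [hσ]
    split_ifs with h1 h2
    exacts [le_rfl, hM0, hd0 t ⟨not_le.1 h1, not_le.1 h2⟩]
  have hσM : ∀ t, σ t ≤ M := by
    intro t
    simp only [hσ]
    split_ifs with h1 h2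
    exacts [hM0, le_rfl, hdM t ⟨not_le.1 h1, not_le.1 h2⟩]
  have hσmono : Monotone σ := by
    intro s t hst
    rcases le_or_gt s 0 with h1 | h1
    · have : σ s = 0 := by simp [hσ, h1]
      rw [this]; exact hσ0 t
    rcases le_or_gt T t with h2 | h2
    · have : σ t = M := by simp [hσ, h2, not_le.2 (hT.trans_le h2)]
      rw [this]; exact hσM s
    have hs : s ∈ Ioo 0 T := ⟨h1, hst.trans_lt h2⟩
    have ht : t ∈ Ioo 0 T := ⟨h1.trans_le hst, h2⟩
    rw [hσI s hs, hσI t ht]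
    exact hκ.monotoneOn_rightDeriv (hint s hs) (hint t ht) hst
  have hσc : ∀ x ∈ Ioo 0 T, κ x < k x → ∀ᶠ s in 𝓝 x, σ s = σ x := by
    intro x hx hlt
    have hn := Icc_mem_nhds hx.1 hx.2
    obtain ⟨m, hm⟩ := convexMinorant_deriv_eventually_const hz hzk hn (hkc.continuousAt hn) hlt
    filter_upwards [hm, Ioo_mem_nhds hx.1 hx.2] with s hs hsI
    rw [hσI s hsI, hσI x hx, hs, hm.self_of_nhds]
  obtain ⟨g, hgc, hgm, hg⟩ := hr.exists_inverse
  obtain ⟨S, hS, hderiv⟩ := hp.exists_finite_hasDerivAt hr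
  have hσpw : PiecewiseContinuousOn σ 0 T := by
    refine ⟨⟨insert 0 (insert T S), (hS.insert T).insert 0, fun t ht => ?_⟩,
      fun t _ => ⟨_, hσmono.tendsto_nhdsGT t⟩, fun t _ => ⟨_, hσmono.tendsto_nhdsLT t⟩⟩
    simp only [Set.mem_sdiff, mem_insert_iff, not_or] at ht
    have htI : t ∈ Ioo 0 T :=
      ⟨lt_of_le_of_ne ht.1.1 (Ne.symm ht.2.1), lt_of_le_of_ne ht.1.2 ht.2.2.1⟩
    refine ContinuousAt.continuousWithinAt ?_
    rcases (hκk t ht.1).lt_or_eq with h | h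
    · exact continuousAt_const.congr (EventuallyEq.symm (hσc t htI h))
    · refine (convexMinorant_deriv_continuousAt hz hzk (Icc_mem_nhds htI.1 htI.2)
        (hderiv t ⟨htI, ht.2.2.2⟩) h).congr ?_
      filter_upwards [Ioo_mem_nhds htI.1 htI.2] with s hs using (hσI s hs).symm
  have hq : IsPowerCurve T fun t => g (σ t) :=
    ⟨fun t _ => (hg _ (hσ0 t)).1, hσpw.comp_continuous hgc⟩
  have hqdata : ∀ t ∈ Icc 0 T, dataCurve r (fun t => g (σ t)) t = κ t := by
    intro t ht
    have h1 : dataCurve r (fun t => g (σ t)) t = ∫ s in (0 : ℝ)..t, σ s :=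
      integral_congr fun s _ => (hg _ (hσ0 s)).2
    have hsub : Icc 0 t ⊆ Icc 0 T := Icc_subset_Icc_right ht.2
    rw [h1, integral_eq_sub_of_hasDeriv_right (f := κ) (by rw [uIcc_of_le ht.1]; exact hκc.mono hsub)
      ?_ hσmono.intervalIntegrable, hκ0, sub_zero]
    intro x hx
    rw [min_eq_left ht.1, max_eq_right ht.1] at hx
    have hxI : x ∈ Ioo 0 T := ⟨hx.1, hx.2.trans_le ht.2⟩
    rw [hσI x hxI]
    exact hκ.hasDerivWithinAt_rightDeriv_of_mem_interior (hint x hxI)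
  have hqmono : MonotoneOn (fun t => g (σ t)) (Icc 0 T) := (hgm.comp hσmono).monotoneOn _
  refine ⟨fun t => g (σ t), hq, hqmono, hκ.congr fun t ht => (hqdata t ht).symm,
    fun t ht => (hqdata t ht).trans_le (hκk t ht), (hqdata T hTI).trans hκT, fun t ht => ?_,
    fun φ hφ hle t ht => (hqdata t ht).symm ▸ le_convexMinorant hφ hle ht⟩
  have hsub : Icc 0 t ⊆ Icc 0 T := Icc_subset_Icc_right ht.2
  have h1 := energyCurve_sub_le_of_monotoneOn hr hp hq h0I ht ht.1 (hqmono.mono hsub)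
    (by rw [dataCurve_zero, dataCurve_zero, hqdata t ht]; linarith [hκk t ht]) (by
      intro x hx
      have hxI : x ∈ Ioo 0 T := ⟨hx.1, hx.2.trans_le ht.2⟩
      have hxI' : x ∈ Icc 0 T := ⟨hxI.1.le, hxI.2.le⟩
      rcases (hκk x hxI').lt_or_eq with h | h
      · right
        filter_upwards [hσc x hxI h] with s hs
        rw [hs]
      · left
        rw [hqdata t ht, hqdata x hxI', h]
        linarith [hκk t ht])
  rw [energyCurve_zero, energyCurve_zero] at h1
  linarith

end IsPowerCurve

/-! ### Point-to-point optimal policies -/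

lemma exists_last_zero {u : ℝ → ℝ} {x y : ℝ} (hxy : x ≤ y) (hu : ContinuousOn u (Icc x y))
    (hx : u x ≤ 0) (hy : 0 < u y) : ∃ a ∈ Ico x y, u a = 0 ∧ ∀ s ∈ Ioc a y, 0 < u s := by
  set Z := Icc x y ∩ u ⁻¹' Iic 0
  have hZ : IsCompact Z :=
    isCompact_Icc.of_isClosed_subset (hu.preimage_isClosed_of_isClosed isClosed_Icc isClosed_Iic)
      inter_subset_left
  obtain ⟨a, ha, hmax⟩ := hZ.exists_isGreatest ⟨x, ⟨le_rfl, hxy⟩, hx⟩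
  have hay : a < y := lt_of_le_of_ne ha.1.2 fun h => not_lt.2 ha.2 (h ▸ hy)
  have hpos : ∀ s ∈ Ioc a y, 0 < u s := fun s hs => by
    by_contra h
    exact absurd (hmax ⟨⟨ha.1.1.trans hs.1.le, hs.2⟩, not_lt.1 h⟩) (not_le.2 hs.1)
  refine ⟨a, ⟨ha.1.1, hay⟩, le_antisymm ha.2 ?_, hpos⟩
  have h1 : Tendsto u (𝓝[Ioc a y] a) (𝓝 (u a)) :=
    (hu a ha.1).mono (Ioc_subset_Icc_self.trans (Icc_subset_Icc_left ha.1.1))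
  have : (𝓝[Ioc a y] a).NeBot := by
    rw [nhdsWithin_Ioc_eq_nhdsGT hay]; infer_instance
  refine ge_of_tendsto h1 ?_
  filter_upwards [self_mem_nhdsWithin] with s hs using (hpos s hs).le

lemma exists_first_zero {u : ℝ → ℝ} {x y : ℝ} (hxy : x ≤ y) (hu : ContinuousOn u (Icc x y))
    (hx : 0 < u x) (hy : u y ≤ 0) : ∃ b ∈ Ioc x y, u b = 0 ∧ ∀ s ∈ Ico x b, 0 < u s := by
  obtain ⟨a, ha, h0, hpos⟩ := exists_last_zero (u := fun s => u (-s)) (neg_le_neg hxy)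
    (hu.comp continuous_neg.continuousOn fun s hs => ⟨by linarith [hs.2], by linarith [hs.1]⟩)
    (by simpa using hy) (by simpa using hx)
  refine ⟨-a, ⟨by linarith [ha.2], by linarith [ha.1]⟩, h0, fun s hs => ?_⟩
  simpa using hpos (-s) ⟨by linarith [hs.2], by linarith [hs.1]⟩

section PointToPoint

variable {T : ℝ} {r E B p q : ℝ → ℝ}

/-- For a strictly concave rate function, the cheapest way of sending a given total amount of data
is unique up to null sets: averaging the rates of two such policies would save energy. -/
theorem IsFeasible.dataCurve_eq_of_energyCurve_le (hT : 0 < T) (hr : IsRateFunction r)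
    (hs : StrictConcaveOn ℝ (Ici 0) r) (hp : IsFeasible T r E B p) (hq : IsFeasible T r E B q)
    (hD : dataCurve r q T = dataCurve r p T) (hE : energyCurve q T ≤ energyCurve p T)
    (hmin : ∀ p', IsFeasible T r E B p' → dataCurve r p' T = dataCurve r p T →
      energyCurve p T ≤ energyCurve p' T) :
    ∀ t ∈ Icc 0 T, dataCurve r q t = dataCurve r p t := by
  have hpc := hp.isPowerCurve
  have hqc := hq.isPowerCurve
  have h0I : (0 : ℝ) ∈ Icc 0 T := ⟨le_rfl, hT.le⟩
  have hTI : T ∈ Icc 0 T := ⟨hT.le, le_rfl⟩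
  obtain ⟨g, hgc, -, hg⟩ := hr.exists_inverse
  set w : ℝ → ℝ := fun t => g ((r (max (p t) 0) + r (max (q t) 0)) / 2) with hw
  have hwr : ∀ t ∈ Icc 0 T, 0 ≤ w t ∧ r (w t) = (r (p t) + r (q t)) / 2 := by
    intro t ht
    simp only [hw, max_eq_left (hpc.nonneg t ht), max_eq_left (hqc.nonneg t ht)]
    exact hg _ (by linarith [hr.nonneg (hpc.nonneg t ht), hr.nonneg (hqc.nonneg t ht)])
  have hwlt : ∀ t ∈ Icc 0 T, p t ≠ q t → w t < (p t + q t) / 2 := by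
    intro t ht hne
    have hp0 := hpc.nonneg t ht
    have hq0 := hqc.nonneg t ht
    have h1 := hs.2 hp0 hq0 hne (by norm_num : (0 : ℝ) < 1 / 2) (by norm_num : (0 : ℝ) < 1 / 2)
      (by norm_num)
    simp only [smul_eq_mul] at h1
    refine (hr.strictMonoOn.lt_iff_lt (hwr t ht).1 (mem_Ici.2 (by linarith))).1 ?_
    rw [(hwr t ht).2, show (p t + q t) / 2 = 1 / 2 * p t + 1 / 2 * q t by ring]
    linarith
  have hwle : ∀ t ∈ Icc 0 T, w t ≤ (p t + q t) / 2 := by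
    intro t ht
    by_cases h : p t = q t
    · refine hr.le_of_le (hwr t ht).1 (by linarith [hpc.nonneg t ht, hqc.nonneg t ht]) ?_
      rw [(hwr t ht).2, ← h, add_self_div_two, add_self_div_two]
    · exact (hwlt t ht h).le
  have hwc : IsPowerCurve T w := by
    refine ⟨fun t ht => (hwr t ht).1, hpc.piecewiseContinuousOn.comp₂ hqc.piecewiseContinuousOn
      (φ := fun z => g ((r (max z.1 0) + r (max z.2 0)) / 2)) ?_⟩
    exact hgc.comp (((hr.continuous_max.comp continuous_fst).add
      (hr.continuous_max.comp continuous_snd)).div_const 2)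
  have hwd : ∀ t ∈ Icc 0 T, dataCurve r w t = (dataCurve r p t + dataCurve r q t) / 2 := by
    intro t ht
    unfold dataCurve
    rw [← integral_add (hpc.integrable_rate hr h0I ht) (hqc.integrable_rate hr h0I ht),
      ← intervalIntegral.integral_div]
    refine integral_congr fun s hs => ?_
    rw [uIcc_of_le ht.1] at hs
    exact (hwr s ⟨hs.1, hs.2.trans ht.2⟩).2
  have havg : ∀ t ∈ Icc 0 T, IntervalIntegrable (fun s => (p s + q s) / 2) volume 0 t :=
    fun t ht => ((hpc.integrable h0I ht).add (hqc.integrable h0I ht)).div_const 2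
  have havgE : ∀ t ∈ Icc 0 T, ∫ s in (0 : ℝ)..t, (p s + q s) / 2 =
      (energyCurve p t + energyCurve q t) / 2 := by
    intro t ht
    rw [intervalIntegral.integral_div, integral_add (hpc.integrable h0I ht)
      (hqc.integrable h0I ht)]
    rfl
  have hwf : IsFeasible T r E B w := by
    refine ⟨hwc, fun t ht => ?_, fun t ht => ?_⟩
    · have h1 := integral_mono_on ht.1 (hwc.integrable h0I ht) (havg t ht) fun s hs =>
        hwle s ⟨hs.1, hs.2.trans ht.2⟩
      rw [havgE t ht] at h1
      have : energyCurve w t ≤ (energyCurve p t + energyCurve q t) / 2 := h1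
      linarith [hp.energy_le t ht, hq.energy_le t ht]
    · rw [hwd t ht]
      linarith [hp.data_le t ht, hq.data_le t ht]
  have hminw := hmin w hwf (by rw [hwd T hTI, hD]; ring)
  -- the energy saved by averaging vanishes, so `p = q` almost everywhere
  have hint : IntervalIntegrable (fun s => (p s + q s) / 2 - w s) volume 0 T :=
    (havg T hTI).sub (hwc.integrable h0I hTI)
  have hzero : ∫ s in (0 : ℝ)..T, ((p s + q s) / 2 - w s) = 0 := by
    refine le_antisymm ?_ (integral_nonneg hT.le fun s hs => sub_nonneg.2 (hwle s hs))
    rw [integral_sub (havg T hTI) (hwc.integrable h0I hTI), havgE T hTI]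
    have : ∫ s in (0 : ℝ)..T, w s = energyCurve w T := rfl
    rw [this]
    linarith
  have hae : (fun s => (p s + q s) / 2 - w s) =ᵐ[volume.restrict (Ioc 0 T)] 0 := by
    refine (integral_eq_zero_iff_of_le_of_nonneg_ae hT.le ?_ hint).1 hzero
    filter_upwards [ae_restrict_mem measurableSet_Ioc] with s hs
    exact sub_nonneg.2 (hwle s ⟨hs.1.le, hs.2⟩)
  rw [EventuallyEq, ae_restrict_iff' measurableSet_Ioc] at hae
  intro t ht
  unfold dataCurve
  refine integral_congr_ae ?_
  filter_upwards [hae] with s hs hs'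
  rw [uIoc_of_le ht.1] at hs'
  have hsI : s ∈ Ioc 0 T := ⟨hs'.1, hs'.2.trans ht.2⟩
  by_contra hne
  have h1 := hwlt s ⟨hsI.1.le, hsI.2⟩ fun h => hne (by rw [h])
  have h2 := hs hsI
  simp only [Pi.zero_apply] at h2
  linarith

/-- If another feasible policy has sent as much data as an optimal one at time `t`, it has used no
less energy, as one could switch from it to the optimal policy at that time. -/
lemma IsOptimal.energyCurve_le (hr : IsRateFunction r) (hp : IsOptimal T r E B p)
    (hq : IsFeasible T r E B q) {t : ℝ} (ht : t ∈ Icc 0 T)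
    (h : dataCurve r q t = dataCurve r p t) : energyCurve p t ≤ energyCurve q t := by
  have hpc := hp.isFeasible.isPowerCurve
  have hqc := hq.isPowerCurve
  have hTI : T ∈ Icc 0 T := ⟨ht.1.trans ht.2, le_rfl⟩
  by_contra! hlt
  have hd : ∀ s ∈ Icc 0 T, t ≤ s → dataCurve r (splice t q p) s = dataCurve r p s := by
    intro s hs hts
    rw [hqc.dataCurve_splice_of_ge hpc hr ht hs hts, h]
    ring
  have hf : IsFeasible T r E B (splice t q p) := by
    refine ⟨hqc.splice hpc t, fun s hs => ?_, fun s hs => ?_⟩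
    · rcases le_total s t with hst | hst
      · rw [IsPowerCurve.energyCurve_splice_of_le hs.1 hst]
        exact hq.energy_le s hs
      · rw [hqc.energyCurve_splice_of_ge hpc ht hs hst]
        linarith [hp.isFeasible.energy_le s hs]
    · rcases le_total s t with hst | hst
      · rw [IsPowerCurve.dataCurve_splice_of_le hs.1 hst]
        exact hq.data_le s hs
      · rw [hd s hs hst]
        exact hp.isFeasible.data_le s hs
  have h1 := hp.energy_min _ hf (hd T hTI ht.2)
  rw [hqc.energyCurve_splice_of_ge hpc ht hTI ht.2] at h1
  linarith

/-- An optimal policy may be replaced by one with increasing power and the same data curve. -/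
theorem IsOptimal.exists_monotoneOn (hT : 0 < T) (hr : IsRateFunction r)
    (hp : IsOptimal T r E B p)
    (hs : StrictConcaveOn ℝ (Ici 0) r ∨ ConvexOn ℝ (Icc 0 T) (dataCurve r p)) :
    ∃ q, IsOptimal T r E B q ∧ MonotoneOn q (Icc 0 T) ∧
      ConvexOn ℝ (Icc 0 T) (dataCurve r q) ∧
      ∀ t ∈ Icc 0 T, dataCurve r q t = dataCurve r p t := by
  have hTI : T ∈ Icc 0 T := ⟨hT.le, le_rfl⟩
  obtain ⟨q, hq, hmono, hconv, hle, hqT, hE, hgr⟩ :=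
    hp.isFeasible.isPowerCurve.exists_convexification hT hr
  have hf : IsFeasible T r E B q := ⟨hq, fun t ht => (hE t ht).trans (hp.isFeasible.energy_le t ht),
    fun t ht => (hle t ht).trans (hp.isFeasible.data_le t ht)⟩
  refine ⟨q, ⟨hf, fun p' hp' => ?_, fun p' hp' h => ?_⟩, hmono, hconv, ?_⟩
  · rw [hqT]; exact hp.data_max p' hp'
  · exact (hE T hTI).trans (hp.energy_min p' hp' (h.trans hqT))
  · rcases hs with hs | hs
    · exact hp.isFeasible.dataCurve_eq_of_energyCurve_le hT hr hs hf hqT (hE T hTI) hp.energy_min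
    · exact fun t ht => le_antisymm (hle t ht) (hgr _ hs (fun _ _ => le_rfl) t ht)

lemma IsOptimal.convexOn_dataCurve (hT : 0 < T) (hr : IsRateFunction r)
    (hp : IsOptimal T r E B p)
    (hs : StrictConcaveOn ℝ (Ici 0) r ∨ ConvexOn ℝ (Icc 0 T) (dataCurve r p)) :
    ConvexOn ℝ (Icc 0 T) (dataCurve r p) := by
  obtain ⟨q, -, -, hq, h⟩ := hp.exists_monotoneOn hT hr hs
  exact hq.congr h

/-- For a strictly concave rate function, the optimal data curve dominates every feasible data
curve of a policy with increasing power. Where the latter is above the optimal one, it is the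
cheaper of the two, and could be followed instead. -/
theorem IsOptimal.dataCurve_le_of_monotoneOn (hT : 0 < T) (hr : IsRateFunction r)
    (hs : StrictConcaveOn ℝ (Ici 0) r) (hp : IsOptimal T r E B p) (hq : IsFeasible T r E B q)
    (hmono : MonotoneOn q (Icc 0 T)) {t : ℝ} (ht : t ∈ Icc 0 T) :
    dataCurve r q t ≤ dataCurve r p t := by
  have hpc := hp.isFeasible.isPowerCurve
  have hqc := hq.isPowerCurve
  have hTI : T ∈ Icc 0 T := ⟨hT.le, le_rfl⟩
  by_contra! hlt
  have hu : ContinuousOn (fun s => dataCurve r q s - dataCurve r p s) (Icc 0 T) :=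
    (hqc.dataCurve_continuousOn hr hT.le).sub (hpc.dataCurve_continuousOn hr hT.le)
  -- `(a, b)` is the maximal interval around `t` on which `q` is ahead
  obtain ⟨a, ha, ha0, hapos⟩ := exists_last_zero ht.1 (hu.mono (Icc_subset_Icc_right ht.2))
    (by simp [dataCurve_zero]) (sub_pos.2 hlt)
  obtain ⟨b, hb, hb0, hbpos⟩ := exists_first_zero ht.2 (hu.mono (Icc_subset_Icc_left ht.1))
    (sub_pos.2 hlt) (sub_nonpos.2 (hp.data_max q hq))
  have haI : a ∈ Icc 0 T := ⟨ha.1, ha.2.le.trans ht.2⟩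
  have hbI : b ∈ Icc 0 T := ⟨ht.1.trans hb.1.le, hb.2⟩
  have hab : a ≤ b := (ha.2.trans hb.1).le
  have hcost := energyCurve_sub_le_of_monotoneOn hr hpc hqc haI hbI hab
    (hmono.mono (Icc_subset_Icc haI.1 hbI.2)) (by linarith) (by
      intro x hx
      left
      have : 0 < dataCurve r q x - dataCurve r p x := by
        rcases le_total x t with h | h
        · exact hapos x ⟨hx.1, h⟩
        · exact hbpos x ⟨h, hx.2⟩
      linarith)
  have hEa := hp.energyCurve_le hr hq haI (by linarith)
  set z := splice b q p
  have hz : IsPowerCurve T z := hqc.splice hpc b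
  set w := splice a p z
  have hw : IsPowerCurve T w := hpc.splice hz a
  have hwmid : ∀ s ∈ Icc a b, dataCurve r w s = dataCurve r q s ∧
      energyCurve w s = energyCurve p a + (energyCurve q s - energyCurve q a) := by
    intro s hs
    have hsI : s ∈ Icc 0 T := ⟨haI.1.trans hs.1, hs.2.trans hbI.2⟩
    rw [hpc.dataCurve_splice_of_ge hz hr haI hsI hs.1,
      hpc.energyCurve_splice_of_ge hz haI hsI hs.1,
      IsPowerCurve.dataCurve_splice_of_le hsI.1 hs.2,
      IsPowerCurve.dataCurve_splice_of_le haI.1 hab,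
      IsPowerCurve.energyCurve_splice_of_le hsI.1 hs.2,
      IsPowerCurve.energyCurve_splice_of_le haI.1 hab]
    exact ⟨by linarith, rfl⟩
  have hwend : ∀ s ∈ Icc b T, dataCurve r w s = dataCurve r p s ∧
      energyCurve w s ≤ energyCurve p s := by
    intro s hs
    have hsI : s ∈ Icc 0 T := ⟨hbI.1.trans hs.1, hs.2⟩
    rw [hpc.dataCurve_splice_of_ge hz hr haI hsI (hab.trans hs.1),
      hpc.energyCurve_splice_of_ge hz haI hsI (hab.trans hs.1),
      hqc.dataCurve_splice_of_ge hpc hr hbI hsI hs.1,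
      IsPowerCurve.dataCurve_splice_of_le haI.1 hab,
      hqc.energyCurve_splice_of_ge hpc hbI hsI hs.1,
      IsPowerCurve.energyCurve_splice_of_le haI.1 hab]
    exact ⟨by linarith, by linarith⟩
  have hwf : IsFeasible T r E B w := by
    refine ⟨hw, fun s hs => ?_, fun s hs => ?_⟩
    · rcases le_total s a with h | h
      · rw [IsPowerCurve.energyCurve_splice_of_le hs.1 h]
        exact hp.isFeasible.energy_le s hs
      rcases le_total s b with h' | h'
      · rw [(hwmid s ⟨h, h'⟩).2]
        linarith [hq.energy_le s hs]
      · exact (hwend s ⟨h', hs.2⟩).2.trans (hp.isFeasible.energy_le s hs)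
    · rcases le_total s a with h | h
      · rw [IsPowerCurve.dataCurve_splice_of_le hs.1 h]
        exact hp.isFeasible.data_le s hs
      rcases le_total s b with h' | h'
      · rw [(hwmid s ⟨h, h'⟩).1]
        exact hq.data_le s hs
      · rw [(hwend s ⟨h', hs.2⟩).1]
        exact hp.isFeasible.data_le s hs
  have heq := hp.isFeasible.dataCurve_eq_of_energyCurve_le hT hr hs hwf
    (hwend T ⟨hbI.2, le_rfl⟩).1 (hwend T ⟨hbI.2, le_rfl⟩).2 hp.energy_min t ht
  rw [(hwmid t ⟨ha.2.le, hb.1.le⟩).1] at heq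
  exact hlt.ne' heq

/-- Remaining silent at first, a feasible policy can be made to send any smaller amount `D` of
data by time `T`. -/
lemma IsFeasible.exists_delayed (hT : 0 < T) (hr : IsRateFunction r) (hp : IsFeasible T r E B p)
    {D : ℝ} (hD : 0 ≤ D) (hDp : D ≤ dataCurve r p T) :
    ∃ q, IsFeasible T r E B q ∧ dataCurve r q T = D ∧ energyCurve q T ≤ energyCurve p T ∧
      (D < dataCurve r p T → energyCurve q T < energyCurve p T) := by
  have hpc := hp.isPowerCurve
  have hTI : T ∈ Icc 0 T := ⟨hT.le, le_rfl⟩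
  have h0I : (0 : ℝ) ∈ Icc 0 T := ⟨le_rfl, hT.le⟩
  obtain ⟨x, hx, hkx⟩ : dataCurve r p T - D ∈ dataCurve r p '' Icc 0 T :=
    intermediate_value_Icc hT.le (hpc.dataCurve_continuousOn hr hT.le)
      ⟨by rw [dataCurve_zero]; linarith, by linarith⟩
  have hzc : IsPowerCurve T fun _ => (0 : ℝ) := .const le_rfl
  have hz : ∀ r' t, r' 0 = 0 → dataCurve r' (fun _ => (0 : ℝ)) t = 0 := fun r' t h => by
    simp [dataCurve, h]
  have hzE : ∀ t, energyCurve (fun _ => (0 : ℝ)) t = 0 := fun t => hz id t rfl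
  have hge : ∀ t ∈ Icc 0 T, x ≤ t →
      dataCurve r (splice x (fun _ => 0) p) t = dataCurve r p t - dataCurve r p x ∧
      energyCurve (splice x (fun _ => 0) p) t = energyCurve p t - energyCurve p x := by
    intro t ht hxt
    rw [hzc.dataCurve_splice_of_ge hpc hr hx ht hxt, hzc.energyCurve_splice_of_ge hpc hx ht hxt,
      hz r x hr.map_zero, hzE, zero_add, zero_add]
    exact ⟨rfl, rfl⟩
  have hEnn : ∀ t ∈ Icc 0 T, 0 ≤ energyCurve p t := fun t ht =>
    hpc.dataCurve_nonneg isRateFunction_id ht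
  refine ⟨splice x (fun _ => 0) p, ⟨hzc.splice hpc x, fun t ht => ?_, fun t ht => ?_⟩, ?_, ?_, ?_⟩
  · refine le_trans ?_ (hp.energy_le t ht)
    rcases le_total t x with h | h
    · rw [IsPowerCurve.energyCurve_splice_of_le ht.1 h, hzE]
      exact hEnn t ht
    · rw [(hge t ht h).2]
      linarith [hEnn x hx]
  · refine le_trans ?_ (hp.data_le t ht)
    rcases le_total t x with h | h
    · rw [IsPowerCurve.dataCurve_splice_of_le ht.1 h, hz r t hr.map_zero]
      exact hpc.dataCurve_nonneg hr ht
    · rw [(hge t ht h).1]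
      linarith [hpc.dataCurve_nonneg hr hx]
  · rw [(hge T hTI hx.2).1, hkx]; ring
  · rw [(hge T hTI hx.2).2]
    linarith [hEnn x hx]
  · intro hlt
    rw [(hge T hTI hx.2).2]
    linarith [hpc.energyCurve_pos hr hx (by rw [hkx]; linarith)]

end PointToPoint

/-! ### Tangent lines -/

section Tangent

variable {T : ℝ} {r E B p q f : ℝ → ℝ} {D m : ℝ}

namespace IsPowerCurve

lemma exists_hasDerivWithinAt_Ioi (hp : IsPowerCurve T p) (hr : IsRateFunction r) {t : ℝ}
    (ht : t ∈ Ico 0 T) : ∃ d, HasDerivWithinAt (dataCurve r p) d (Ioi t) t := by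
  have hrate := hp.rate hr
  obtain ⟨d, hd⟩ := hrate.2.1 t ht
  refine ⟨d, HasDerivWithinAt.mono (t := Ici t) ?_ Ioi_subset_Ici_self⟩
  refine integral_hasDerivWithinAt_of_tendsto_ae_right (t := Ioi t)
    (hp.integrable_rate hr ⟨le_rfl, ht.1.trans ht.2.le⟩ ⟨ht.1, ht.2.le⟩)
    ⟨Icc 0 T, ?_, hrate.aestronglyMeasurable⟩ (hd.mono_left inf_le_left)
  exact mem_of_superset (Ioo_mem_nhdsGT ht.2) fun s hs => ⟨ht.1.trans hs.1.le, hs.2.le⟩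

lemma exists_hasDerivWithinAt_Iio (hp : IsPowerCurve T p) (hr : IsRateFunction r) {t : ℝ}
    (ht : t ∈ Ioc 0 T) : ∃ d, HasDerivWithinAt (dataCurve r p) d (Iio t) t := by
  have hrate := hp.rate hr
  obtain ⟨d, hd⟩ := hrate.2.2 t ht
  refine ⟨d, HasDerivWithinAt.mono (t := Iic t) ?_ Iio_subset_Iic_self⟩
  refine integral_hasDerivWithinAt_of_tendsto_ae_right (t := Iic t)
    (hp.integrable_rate hr ⟨le_rfl, ht.1.le.trans ht.2⟩ ⟨ht.1.le, ht.2⟩)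
    ⟨Icc 0 T, ?_, hrate.aestronglyMeasurable⟩ (hd.mono_left ?_)
  · exact mem_of_superset (Ioc_mem_nhdsLE ht.1) fun s hs => ⟨hs.1.le, hs.2.trans ht.2⟩
  · -- the value at `t` itself plays no role, as `{t}` is a null set
    have h1 : 𝓝[<] t = 𝓝[≤] t ⊓ 𝓟 {t}ᶜ := by
      rw [nhdsWithin, nhdsWithin, inf_assoc, inf_principal, ← sdiff_eq, Iic_sdiff_right]
    rw [h1]
    exact inf_le_inf_left _ (le_principal_iff.2 (compl_mem_ae_iff.2 (measure_singleton t)))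

end IsPowerCurve

lemma line_le_of_isTangent (hf : ConvexOn ℝ (Icc 0 T) f) (h : IsTangent T f D m) :
    ∀ t ∈ Icc 0 T, line T D m t ≤ f t := by
  obtain ⟨t₀, ht₀, heq, hl, hr⟩ := h
  intro t ht
  rcases lt_trichotomy t t₀ with h | h | h
  · obtain ⟨d, hd, hdm⟩ := hl (ht.1.trans_lt h)
    have h1 := (hf.slope_le_of_hasDerivWithinAt_Iio ht ht₀ h hd).trans hdm
    rw [slope_def_field, div_le_iff₀ (sub_pos.2 h), ← heq] at h1
    unfold line at *
    linarith
  · rw [h, heq]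
  · obtain ⟨d, hd, hdm⟩ := hr (h.trans_le ht.2)
    have h1 := hdm.trans (hf.le_slope_of_hasDerivWithinAt_Ioi ht₀ ht h hd)
    rw [slope_def_field, le_div_iff₀ (sub_pos.2 h), ← heq] at h1
    unfold line at *
    linarith

lemma exists_isLastMeeting (hf : ContinuousOn f (Icc 0 T)) (h : IsTangent T f D m) :
    ∃ T₁, IsLastMeeting T f D m T₁ := by
  obtain ⟨t₀, ht₀, heq, -⟩ := h
  have hc : ContinuousOn (fun t => line T D m t - f t) (Icc 0 T) :=
    ContinuousOn.sub (by unfold line; fun_prop) hf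
  have hset : {t | t ∈ Icc 0 T ∧ line T D m t = f t} =
      Icc 0 T ∩ (fun t => line T D m t - f t) ⁻¹' {0} := by
    ext t
    simp [sub_eq_zero]
  have hK : IsCompact {t | t ∈ Icc 0 T ∧ line T D m t = f t} := by
    rw [hset]
    exact isCompact_Icc.of_isClosed_subset
      (hc.preimage_isClosed_of_isClosed isClosed_Icc isClosed_singleton) inter_subset_left
  exact hK.exists_isGreatest ⟨t₀, ht₀, heq⟩

/-- A line below the graph that touches it before time `T` is tangent, if the one-sided
derivatives exist. -/
lemma isTangent_of_line_le {t₀ : ℝ} (ht₀ : t₀ ∈ Icc 0 T) (heq : line T D m t₀ = f t₀)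
    (hle : ∀ t ∈ Icc 0 T, line T D m t ≤ f t)
    (hl : 0 < t₀ → ∃ d, HasDerivWithinAt f d (Iio t₀) t₀)
    (hr : t₀ < T → ∃ d, HasDerivWithinAt f d (Ioi t₀) t₀) : IsTangent T f D m := by
  refine ⟨t₀, ht₀, heq, fun h => ?_, fun h => ?_⟩
  · obtain ⟨d, hd⟩ := hl h
    refine ⟨d, hd, ?_⟩
    rw [hasDerivWithinAt_iff_tendsto_slope' (by simp)] at hd
    refine le_of_tendsto hd ?_
    filter_upwards [Ioo_mem_nhdsLT h] with s hs
    have h1 := hle s ⟨hs.1.le, hs.2.le.trans ht₀.2⟩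
    rw [slope_comm, slope_def_field, div_le_iff₀ (sub_pos.2 hs.2), ← heq]
    unfold line at *
    linarith
  · obtain ⟨d, hd⟩ := hr h
    refine ⟨d, hd, ?_⟩
    rw [hasDerivWithinAt_iff_tendsto_slope' (by simp)] at hd
    refine ge_of_tendsto hd ?_
    filter_upwards [Ioo_mem_nhdsGT h] with s hs
    have h1 := hle s ⟨ht₀.1.trans hs.1.le, hs.2.le⟩
    rw [slope_def_field, le_div_iff₀ (sub_pos.2 hs.1), ← heq]
    unfold line at *
    linarith

/-- There is a tangent line to a data curve through any point `(T, D)` below it. -/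
lemma IsPowerCurve.exists_isTangent (hT : 0 < T) (hr : IsRateFunction r) (hp : IsPowerCurve T p)
    (hD0 : 0 ≤ D) (hD : D ≤ dataCurve r p T) :
    ∃ m, IsTangent T (dataCurve r p) D m := by
  set f := dataCurve r p with hfdef
  have hTI : T ∈ Icc 0 T := ⟨hT.le, le_rfl⟩
  have hfc : ContinuousOn f (Icc 0 T) := hp.dataCurve_continuousOn hr hT.le
  rcases hD.eq_or_lt with h | h
  · obtain ⟨d, hd⟩ := hp.exists_hasDerivWithinAt_Iio hr ⟨hT, le_rfl⟩
    exact ⟨d, T, hTI, by simp [line, h], fun _ => ⟨d, hd, le_rfl⟩, fun h => absurd h (lt_irrefl T)⟩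
  -- `f` exceeds `D` on `[b, T]`; on `[0, b]` the slope of the lines to `(T, D)` has a maximum
  obtain ⟨b, hb, hfb⟩ : ∃ b ∈ Ico 0 T, ∀ s ∈ Icc b T, D < f s := by
    obtain ⟨a, ha, -, hpos⟩ := exists_last_zero hT.le (hfc.sub (continuousOn_const (c := D)))
      (by simp [hfdef, dataCurve_zero, hD0]) (sub_pos.2 h)
    refine ⟨(a + T) / 2, ⟨by linarith [ha.1], by linarith [ha.2]⟩, fun s hs => ?_⟩
    exact sub_pos.1 (hpos s ⟨by linarith [hs.1, ha.2], hs.2⟩)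
  obtain ⟨t₀, ht₀, hmax⟩ := isCompact_Icc.exists_isMaxOn (nonempty_Icc.2 hb.1)
    (f := fun t => (D - f t) / (T - t)) (by
      refine ContinuousOn.div (continuousOn_const.sub (hfc.mono (Icc_subset_Icc_right hb.2.le)))
        (by fun_prop) fun s hs => ?_
      linarith [hs.2, hb.2])
  set m := (D - f t₀) / (T - t₀) with hm
  have ht₀T : t₀ < T := ht₀.2.trans_lt hb.2
  have hm0 : 0 ≤ m := by
    have h1 : (D - f 0) / (T - 0) ≤ m := hmax ⟨le_rfl, hb.1⟩
    refine le_trans ?_ h1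
    rw [hfdef, dataCurve_zero, sub_zero, sub_zero]
    positivity
  refine ⟨m, isTangent_of_line_le (t₀ := t₀) ⟨ht₀.1, ht₀T.le⟩ ?_ ?_
    (fun h => hp.exists_hasDerivWithinAt_Iio hr ⟨h, ht₀T.le⟩)
    (fun h => hp.exists_hasDerivWithinAt_Ioi hr ⟨ht₀.1, h⟩)⟩
  · have h1 : m * (T - t₀) = D - f t₀ := div_mul_cancel₀ _ (by linarith)
    unfold line
    linarith
  · intro t ht
    unfold line
    rcases le_total t b with h1 | h1
    · have h2 : (D - f t) / (T - t) ≤ m := hmax ⟨ht.1, h1⟩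
      rw [div_le_iff₀ (by linarith [hb.2])] at h2
      linarith
    · have h2 := hfb t ⟨h1, ht.2⟩
      have h3 := mul_nonneg hm0 (sub_nonneg.2 ht.2)
      linarith

end Tangent

/-! ### The source policy that follows the tangent -/

/-- The data of the tangent construction: an optimal source policy `q` of increasing power, and a
line of slope `m` and end value `D` below its data curve that meets it at time `T₁`. `P` is the
power that achieves the rate `m`. -/
structure IsTangentSetup (T : ℝ) (r E B q : ℝ → ℝ) (D m T₁ P : ℝ) : Prop where
  isRate : IsRateFunction r
  isOptimal : IsOptimal T r E B q
  monotoneOn : MonotoneOn q (Icc 0 T)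
  line_le : ∀ t ∈ Icc 0 T, line T D m t ≤ dataCurve r q t
  mem_Icc : T₁ ∈ Icc 0 T
  line_eq : line T D m T₁ = dataCurve r q T₁
  power_nonneg : 0 ≤ P
  rate_power : r P = m

namespace IsTangentSetup

variable {T : ℝ} {r E B q : ℝ → ℝ} {D m T₁ P : ℝ}

/-- The source policy whose data curve is the hat curve: `q` before `T₁`, then the constant
power `P`. -/
noncomputable abbrev hatPolicy (q : ℝ → ℝ) (T₁ P : ℝ) : ℝ → ℝ := splice T₁ q fun _ => P

lemma isPowerCurve (h : IsTangentSetup T r E B q D m T₁ P) :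
    IsPowerCurve T (hatPolicy q T₁ P) :=
  h.isOptimal.isFeasible.isPowerCurve.splice (.const h.power_nonneg) _

lemma dataCurve_of_ge (h : IsTangentSetup T r E B q D m T₁ P) {t : ℝ} (ht : t ∈ Icc T₁ T) :
    dataCurve r (hatPolicy q T₁ P) t = line T D m t := by
  have hc : ∀ s, dataCurve r (fun _ => P) s = m * s := fun s => by
    simp [dataCurve, h.rate_power, mul_comm]
  have h1 := h.isOptimal.isFeasible.isPowerCurve.dataCurve_splice_of_ge (.const h.power_nonneg)
    h.isRate h.mem_Icc ⟨h.mem_Icc.1.trans ht.1, ht.2⟩ ht.1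
  rw [h1, hc, hc, ← h.line_eq]
  unfold line
  ring

lemma energyCurve_of_ge (h : IsTangentSetup T r E B q D m T₁ P) {t : ℝ} (ht : t ∈ Icc T₁ T) :
    energyCurve (hatPolicy q T₁ P) t = energyCurve q T₁ + P * (t - T₁) := by
  have hc : ∀ s, energyCurve (fun _ => P) s = P * s := fun s => by
    simp [energyCurve, mul_comm]
  have h1 := h.isOptimal.isFeasible.isPowerCurve.energyCurve_splice_of_ge (.const h.power_nonneg)
    h.mem_Icc ⟨h.mem_Icc.1.trans ht.1, ht.2⟩ ht.1
  rw [h1, hc, hc]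
  ring

lemma dataCurve_le (h : IsTangentSetup T r E B q D m T₁ P) {t : ℝ} (ht : t ∈ Icc 0 T) :
    dataCurve r (hatPolicy q T₁ P) t ≤ dataCurve r q t := by
  rcases le_total t T₁ with h1 | h1
  · rw [IsPowerCurve.dataCurve_splice_of_le ht.1 h1]
  · rw [h.dataCurve_of_ge ⟨h1, ht.2⟩]
    exact h.line_le t ht

lemma isFeasible (h : IsTangentSetup T r E B q D m T₁ P) :
    IsFeasible T r E B (hatPolicy q T₁ P) := by
  have hq := h.isOptimal.isFeasible
  refine ⟨h.isPowerCurve, fun t ht => ?_, fun t ht => (h.dataCurve_le ht).trans (hq.data_le t ht)⟩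
  refine le_trans ?_ (hq.energy_le t ht)
  rcases le_total t T₁ with h1 | h1
  · rw [IsPowerCurve.energyCurve_splice_of_le ht.1 h1]
  · rw [h.energyCurve_of_ge ⟨h1, ht.2⟩]
    obtain ⟨c, -, hc0, hc⟩ := h.isRate.exists_marginal_cost
    have h2 := hq.isPowerCurve.jensen h.isRate (fun x hx => hc P x h.power_nonneg hx)
      h.mem_Icc ht h1
    have h3 : 0 ≤ c P * (dataCurve r q t - dataCurve r q T₁ - r P * (t - T₁)) := by
      refine mul_nonneg (hc0 P) ?_
      rw [h.rate_power, ← h.line_eq]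
      have := h.line_le t ht
      unfold line at *
      linarith
    linarith

lemma hatPolicy_monotoneOn (h : IsTangentSetup T r E B q D m T₁ P) :
    MonotoneOn (hatPolicy q T₁ P) (Icc 0 T) := by
  have hq := h.isOptimal.isFeasible.isPowerCurve
  -- since the line is below the data curve and meets it at `T₁`, the rate before `T₁` is below `m`
  have hle : ∀ s ∈ Icc 0 T, s < T₁ → q s ≤ P := by
    intro s hs hsT
    refine h.isRate.le_of_le (hq.nonneg s hs) h.power_nonneg ?_
    have h1 := integral_mono_on hsT.le intervalIntegrable_const
      (hq.integrable_rate h.isRate hs h.mem_Icc) (f := fun _ => r (q s)) fun u hu => by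
        have huI : u ∈ Icc 0 T := ⟨hs.1.trans hu.1, hu.2.trans h.mem_Icc.2⟩
        exact h.isRate.monotoneOn (hq.nonneg s hs) (hq.nonneg u huI) (h.monotoneOn hs huI hu.1)
    rw [← hq.dataCurve_sub h.isRate hs h.mem_Icc, intervalIntegral.integral_const, smul_eq_mul,
      ← h.line_eq] at h1
    have h2 := h.line_le s hs
    rw [h.rate_power]
    have h3 : (T₁ - s) * r (q s) ≤ (T₁ - s) * m := by
      unfold line at *
      linarith
    exact le_of_mul_le_mul_left h3 (sub_pos.2 hsT)
  intro s hs t ht hst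
  simp only [hatPolicy, splice]
  split_ifs with h1 h2 h2
  · exact h.monotoneOn hs ht hst
  · exact hle s hs h1
  · exact absurd (hst.trans_lt h2) h1
  · exact le_rfl

/-- The hat policy uses the least energy among the feasible policies that send the amount `D`.
Let `p'` be another one. If `p'` is ahead of `q` at `T₁`, their data curves meet at a later `τ`;
then `p'` has used at least as much energy as `q` by `τ`, and sending the rest costs at least as
much as along the line, by Jensen's inequality. If `p'` is behind at `T₁`, their data curves last
meet at a time `τ` before `T₁`, and after `τ` the comparison with an increasing policy applies. -/
theorem energyCurve_le (h : IsTangentSetup T r E B q D m T₁ P) {p' : ℝ → ℝ}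
    (hp' : IsFeasible T r E B p') (hD : dataCurve r p' T = D) :
    energyCurve (hatPolicy q T₁ P) T ≤ energyCurve p' T := by
  have hq := h.isOptimal.isFeasible.isPowerCurve
  have hpc := hp'.isPowerCurve
  have hr := h.isRate
  have hT : 0 ≤ T := h.mem_Icc.1.trans h.mem_Icc.2
  have hTI : T ∈ Icc 0 T := ⟨hT, le_rfl⟩
  have hlineT : line T D m T = D := by simp [line]
  have hu : ContinuousOn (fun t => dataCurve r q t - dataCurve r p' t) (Icc 0 T) :=
    (hq.dataCurve_continuousOn hr hT).sub (hpc.dataCurve_continuousOn hr hT)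
  rcases le_or_gt (dataCurve r q T₁) (dataCurve r p' T₁) with hcase | hcase
  · obtain ⟨τ, hτ, hτ0⟩ : (0 : ℝ) ∈ (fun t => dataCurve r q t - dataCurve r p' t) '' Icc T₁ T :=
      intermediate_value_Icc h.mem_Icc.2 (hu.mono (Icc_subset_Icc_left h.mem_Icc.1))
        ⟨by linarith, by have := h.line_le T hTI; linarith⟩
    simp only at hτ0
    have hτI : τ ∈ Icc 0 T := ⟨h.mem_Icc.1.trans hτ.1, hτ.2⟩
    obtain ⟨c, -, hc0, hc⟩ := hr.exists_marginal_cost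
    have h1 := hq.jensen hr (fun x hx => hc P x h.power_nonneg hx) h.mem_Icc hτI hτ.1
    have h2 := hpc.jensen hr (fun x hx => hc P x h.power_nonneg hx) hτI hTI hτ.2
    have h3 := h.isOptimal.energyCurve_le hr hp' hτI (by linarith)
    have h4 : (dataCurve r q τ - dataCurve r q T₁ - r P * (τ - T₁)) +
        (dataCurve r p' T - dataCurve r p' τ - r P * (T - τ)) = 0 := by
      rw [h.rate_power, ← h.line_eq, hD]
      unfold line
      linarith
    have h5 := congrArg (c P * ·) h4
    simp only [mul_add (c P) (_ - _), mul_zero] at h5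
    rw [h.energyCurve_of_ge ⟨h.mem_Icc.2, le_rfl⟩]
    linarith
  · obtain ⟨τ, hτ, hτ0, hpos⟩ := exists_last_zero h.mem_Icc.1
      (hu.mono (Icc_subset_Icc_right h.mem_Icc.2)) (by simp [dataCurve_zero]) (sub_pos.2 hcase)
    have hτI : τ ∈ Icc 0 T := ⟨hτ.1, hτ.2.le.trans h.mem_Icc.2⟩
    have hhatT : dataCurve r (hatPolicy q T₁ P) T = D := by
      rw [h.dataCurve_of_ge ⟨h.mem_Icc.2, le_rfl⟩, hlineT]
    have hhat : ∀ x, 0 ≤ x → x ≤ T₁ → dataCurve r (hatPolicy q T₁ P) x = dataCurve r q x :=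
      fun x h0 h1 => IsPowerCurve.dataCurve_splice_of_le h0 h1
    have h1 := energyCurve_sub_le_of_monotoneOn hr hpc h.isPowerCurve hτI hTI hτI.2
      (h.hatPolicy_monotoneOn.mono (Icc_subset_Icc_left hτ.1))
      (by rw [hhatT, hD, hhat τ hτ.1 hτ.2.le]; linarith) (by
        intro x hx
        rcases le_or_gt x T₁ with hxT | hxT
        · left
          rw [hhatT, hD, hhat x (hτ.1.trans hx.1.le) hxT]
          linarith [hpos x ⟨hx.1, hxT⟩]
        · right
          filter_upwards [Ioi_mem_nhds hxT] with s hs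
          simp [splice, not_lt.2 (mem_Ioi.1 hs).le, not_lt.2 hxT.le])
    rw [IsPowerCurve.energyCurve_splice_of_le (p := q) hτ.1 hτ.2.le] at h1
    have h3 := h.isOptimal.energyCurve_le hr hp' hτI (by linarith)
    linarith

end IsTangentSetup

/-! ### The two-hop problem -/

/-- Against an optimal source policy `ps`, a relay policy that is feasible for another feasible
source policy `p'` gains nothing: it delivers at most the optimal amount of data, and delivering
that amount costs at least the optimal energy. Its convexification is below that of `p'`, hence
below the data curve of `ps`, hence feasible for the relay when the source uses `ps`. -/
theorem IsFeasiblePair.relay_le {T : ℝ} {rsr rrd Es Er Bs ps pr p' q' : ℝ → ℝ} (hT : 0 < T)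
    (hrsr : IsRateFunction rsr) (hrrd : IsRateFunction rrd)
    (hs : StrictConcaveOn ℝ (Ici 0) rsr) (hps : IsOptimal T rsr Es Bs ps)
    (hpr : IsOptimal T rrd Er (dataCurve rsr ps) pr)
    (h : IsFeasiblePair T rsr rrd Es Er Bs p' q') :
    dataCurve rrd q' T ≤ dataCurve rrd pr T ∧
      (dataCurve rrd q' T = dataCurve rrd pr T → energyCurve pr T ≤ energyCurve q' T) := by
  have hTI : T ∈ Icc 0 T := ⟨hT.le, le_rfl⟩
  obtain ⟨p₁, hp₁, hp₁mono, -, hp₁le, -, hp₁E, hp₁gr⟩ :=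
    h.source.isPowerCurve.exists_convexification hT hrsr
  obtain ⟨q₁, hq₁, -, hq₁conv, hq₁le, hq₁T, hq₁E, -⟩ :=
    h.relay.isPowerCurve.exists_convexification hT hrrd
  have hp₁f : IsFeasible T rsr Es Bs p₁ :=
    ⟨hp₁, fun t ht => (hp₁E t ht).trans (h.source.energy_le t ht),
      fun t ht => (hp₁le t ht).trans (h.source.data_le t ht)⟩
  have hq₁f : IsFeasible T rrd Er (dataCurve rsr ps) q₁ :=
    ⟨hq₁, fun t ht => (hq₁E t ht).trans (h.relay.energy_le t ht), fun t ht =>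
      (hp₁gr _ hq₁conv (fun s hs' => (hq₁le s hs').trans (h.relay.data_le s hs')) t ht).trans
        (hps.dataCurve_le_of_monotoneOn hT hrsr hs hp₁f hp₁mono ht)⟩
  refine ⟨?_, fun heq => ?_⟩
  · rw [← hq₁T]
    exact hpr.data_max q₁ hq₁f
  · exact (hpr.energy_min q₁ hq₁f (hq₁T.trans heq)).trans (hq₁E T hTI)

end TwoHop

/-- `ps` is the source-optimal policy, `pr` the relay-optimal policy when the source uses `ps`,
`D` the data delivered by `pr`. For a rate function that is not strictly concave there can be many
optimal policies, and one with a convex data curve is taken; if it is strictly concave, convexity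
is part of the conclusion. -/
theorem theorem3p2
    (T : ℝ) (hT : 0 < T)
    (rsr rrd : ℝ → ℝ) (hrsr : TwoHop.IsRateFunction rsr) (hrrd : TwoHop.IsRateFunction rrd)
    (Es Er Bs : ℝ → ℝ)
    (ps : ℝ → ℝ) (hps : TwoHop.IsOptimal T rsr Es Bs ps)
    (pr : ℝ → ℝ) (hpr : TwoHop.IsOptimal T rrd Er (TwoHop.dataCurve rsr ps) pr)
    (hs : StrictConcaveOn ℝ (Set.Ici 0) rsr ∨
      ConvexOn ℝ (Set.Icc 0 T) (TwoHop.dataCurve rsr ps))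
    (hr : StrictConcaveOn ℝ (Set.Ici 0) rrd ∨
      ConvexOn ℝ (Set.Icc 0 T) (TwoHop.dataCurve rrd pr))
    (D : ℝ) (hD : D = TwoHop.dataCurve rrd pr T) :
    -- both optimal data curves are convex, and the tangent and the last meeting point exist
    ConvexOn ℝ (Set.Icc 0 T) (TwoHop.dataCurve rsr ps) ∧
    ConvexOn ℝ (Set.Icc 0 T) (TwoHop.dataCurve rrd pr) ∧
    (∃ m T₁ : ℝ, TwoHop.IsTangent T (TwoHop.dataCurve rsr ps) D m ∧
      TwoHop.IsLastMeeting T (TwoHop.dataCurve rsr ps) D m T₁) ∧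
    ∀ m T₁ : ℝ, TwoHop.IsTangent T (TwoHop.dataCurve rsr ps) D m →
      TwoHop.IsLastMeeting T (TwoHop.dataCurve rsr ps) D m T₁ →
      ∃ p : ℝ → ℝ,
        -- `p` is feasible at the source, and its data curve is the claimed one
        TwoHop.IsFeasible T rsr Es Bs p ∧
        (∀ t ∈ Set.Icc 0 T, TwoHop.dataCurve rsr p t =
          TwoHop.hatCurve T (TwoHop.dataCurve rsr ps) D m T₁ t) ∧
        -- the relay-optimal policy stays feasible, and optimal, when the source uses `p`
        TwoHop.IsOptimal T rrd Er (TwoHop.dataCurve rsr p) pr ∧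
        -- `p` uses the least source energy among feasible policies sending as much data
        TwoHop.dataCurve rsr p T = D ∧
        (∀ p', TwoHop.IsFeasible T rsr Es Bs p' → TwoHop.dataCurve rsr p' T = D →
          TwoHop.energyCurve p T ≤ TwoHop.energyCurve p' T) ∧
        -- uniqueness, and optimality for the two-hop problem
        (StrictConcaveOn ℝ (Set.Ici 0) rsr →
          (∀ p', TwoHop.IsFeasible T rsr Es Bs p' → TwoHop.dataCurve rsr p' T = D →
            (∃ t ∈ Set.Icc 0 T, TwoHop.dataCurve rsr p' t ≠ TwoHop.dataCurve rsr p t) →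
            TwoHop.energyCurve p T < TwoHop.energyCurve p' T) ∧
          TwoHop.IsOptimalPair T rsr rrd Es Er Bs p pr ∧
          ∀ p' q', TwoHop.IsOptimalPair T rsr rrd Es Er Bs p' q' →
            ∀ t ∈ Set.Icc 0 T, TwoHop.dataCurve rsr p' t =
              TwoHop.hatCurve T (TwoHop.dataCurve rsr ps) D m T₁ t) := by
  have h0I : (0 : ℝ) ∈ Icc 0 T := ⟨le_rfl, hT.le⟩
  have hTI : T ∈ Icc 0 T := ⟨hT.le, le_rfl⟩
  have hfconv := hps.convexOn_dataCurve hT hrsr hs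
  have hBconv := hpr.convexOn_dataCurve hT hrrd hr
  have hpsc := hps.isFeasible.isPowerCurve
  have hD0 : 0 ≤ D := hD ▸ hpr.isFeasible.isPowerCurve.dataCurve_nonneg hrrd hTI
  have hDf : D ≤ TwoHop.dataCurve rsr ps T := hD ▸ hpr.isFeasible.data_le T hTI
  refine ⟨hfconv, hBconv, ?_, ?_⟩
  · obtain ⟨m, hm⟩ := hpsc.exists_isTangent hT hrsr hD0 hDf
    obtain ⟨T₁, hT₁⟩ :=
      TwoHop.exists_isLastMeeting (hpsc.dataCurve_continuousOn hrsr hT.le) hm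
    exact ⟨m, T₁, hm, hT₁⟩
  intro m T₁ hm hT₁
  obtain ⟨⟨hT₁I, hT₁eq⟩, -⟩ := hT₁
  have hline := TwoHop.line_le_of_isTangent hfconv hm
  have hm0 : 0 ≤ m := by
    have h1 := hline 0 h0I
    rw [TwoHop.dataCurve_zero, TwoHop.line] at h1
    exact nonneg_of_mul_nonneg_left (show 0 ≤ m * T by linarith) hT
  obtain ⟨q, hq, hqmono, -, hqd⟩ := hps.exists_monotoneOn hT hrsr hs
  obtain ⟨g, -, -, hg⟩ := hrsr.exists_inverse
  have setup : TwoHop.IsTangentSetup T rsr Es Bs q D m T₁ (g m) :=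
    ⟨hrsr, hq, hqmono, fun t ht => by rw [hqd t ht]; exact hline t ht, hT₁I,
      by rw [hqd T₁ hT₁I]; exact hT₁eq, (hg m hm0).1, (hg m hm0).2⟩
  set p := TwoHop.IsTangentSetup.hatPolicy q T₁ (g m) with hp
  have hpT : TwoHop.dataCurve rsr p T = D := by
    rw [setup.dataCurve_of_ge ⟨hT₁I.2, le_rfl⟩]
    simp [TwoHop.line]
  have hhat : ∀ t ∈ Icc 0 T, TwoHop.dataCurve rsr p t =
      TwoHop.hatCurve T (TwoHop.dataCurve rsr ps) D m T₁ t := by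
    intro t ht
    unfold TwoHop.hatCurve
    split_ifs with h
    · rw [TwoHop.IsPowerCurve.dataCurve_splice_of_le ht.1 h, hqd t ht]
    · exact setup.dataCurve_of_ge ⟨(not_le.1 h).le, ht.2⟩
  have hple : ∀ t ∈ Icc 0 T, TwoHop.dataCurve rsr p t ≤ TwoHop.dataCurve rsr ps t :=
    fun t ht => (setup.dataCurve_le ht).trans (hqd t ht).le
  -- after `T₁` the convex relay data curve is below its chord, and hence below the line
  have hrelay : TwoHop.IsOptimal T rrd Er (TwoHop.dataCurve rsr p) pr := by
    refine ⟨⟨hpr.isFeasible.isPowerCurve, hpr.isFeasible.energy_le, fun t ht => ?_⟩,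
      fun p' hp' => hpr.data_max p' ⟨hp'.isPowerCurve, hp'.energy_le,
        fun t ht => (hp'.data_le t ht).trans (hple t ht)⟩,
      fun p' hp' => hpr.energy_min p' ⟨hp'.isPowerCurve, hp'.energy_le,
        fun t ht => (hp'.data_le t ht).trans (hple t ht)⟩⟩
    rcases le_total t T₁ with h | h
    · rw [TwoHop.IsPowerCurve.dataCurve_splice_of_le ht.1 h, hqd t ht]
      exact hpr.isFeasible.data_le t ht
    · rw [setup.dataCurve_of_ge ⟨h, ht.2⟩]
      have hconv := hBconv.add (TwoHop.convexOn_affine (convex_Icc 0 T) (-D) (-m) T)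
      have h1 := hconv.le_max_of_mem_Icc hT₁I hTI ⟨h, ht.2⟩
      have h2 := hpr.isFeasible.data_le T₁ hT₁I
      rw [← hT₁eq] at h2
      simp only [Pi.add_apply, TwoHop.line, ← hD, sub_self, mul_zero, add_zero,
        add_neg_cancel] at h1 h2 ⊢
      rcases le_max_iff.1 h1 with h3 | h3 <;> linarith
  refine ⟨p, setup.isFeasible, hhat, hrelay, hpT, fun p' hp' h => setup.energyCurve_le hp' h, ?_⟩
  intro hstrict
  have huniq : ∀ p', TwoHop.IsFeasible T rsr Es Bs p' → TwoHop.dataCurve rsr p' T = D →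
      (∃ t ∈ Icc 0 T, TwoHop.dataCurve rsr p' t ≠ TwoHop.dataCurve rsr p t) →
      TwoHop.energyCurve p T < TwoHop.energyCurve p' T := by
    rintro p' hp' hDp' ⟨t, ht, hne⟩
    by_contra! hle
    exact hne (setup.isFeasible.dataCurve_eq_of_energyCurve_le hT hrsr hstrict hp'
      (hDp'.trans hpT.symm) hle (fun w hw h => setup.energyCurve_le hw (h.trans hpT)) t ht)
  have hpair : TwoHop.IsFeasiblePair T rsr rrd Es Er Bs p pr :=
    ⟨setup.isFeasible, hrelay.isFeasible⟩
  have hDle : ∀ p' q', TwoHop.IsFeasiblePair T rsr rrd Es Er Bs p' q' →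
      TwoHop.dataCurve rrd q' T = D → D ≤ TwoHop.dataCurve rsr p' T := fun p' q' h hq' =>
    hq' ▸ h.relay.data_le T hTI
  have hopt : TwoHop.IsOptimalPair T rsr rrd Es Er Bs p pr := by
    refine ⟨hpair, fun p' q' h => (h.relay_le hT hrsr hrrd hstrict hps hpr).1,
      fun p' q' h hq' => ?_, fun p' q' h => (h.relay_le hT hrsr hrrd hstrict hps hpr).2⟩
    obtain ⟨w, hw, hwT, hwE, -⟩ :=
      h.source.exists_delayed hT hrsr hD0 (hDle p' q' h (hq'.trans hD.symm))
    exact (setup.energyCurve_le hw hwT).trans hwE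
  refine ⟨huniq, hopt, fun p' q' h t ht => ?_⟩
  have hq'D : TwoHop.dataCurve rrd q' T = D := by
    rw [hD]
    exact le_antisymm (hopt.data_max p' q' h.isFeasiblePair) (h.data_max p pr hpair)
  have hEle := h.source_energy_min p pr hpair (hD.symm.trans hq'D.symm)
  obtain ⟨w, hw, hwT, -, hwlt⟩ :=
    h.isFeasiblePair.source.exists_delayed hT hrsr hD0 (hDle p' q' h.isFeasiblePair hq'D)
  rcases (hDle p' q' h.isFeasiblePair hq'D).eq_or_lt with heq | hlt
  · rw [← hhat t ht]
    by_contra hne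
    exact absurd hEle (not_le.2 (huniq p' h.isFeasiblePair.source heq.symm ⟨t, ht, hne⟩))
  · exact absurd ((setup.energyCurve_le hw hwT).trans_lt (hwlt hlt)) (not_lt.2 hEle)
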